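/- Let $(\Omega,\mu)$ be a probability space, $\Sigma$ an infinite index set and $(d_\sigma)_{\sigma\in\Sigma}$ a family of positive integers. Let $\mathcal R=\{\rho^\sigma:\Omega\to O(d_\sigma)\}_{\sigma\in\Sigma}$ be a quantized Rademacher system, that is, a family of independent random orthogonal matrices such that $\rho^\sigma$ is distributed according to the normalized Haar measure of the orthogonal group $O(d_\sigma)$; regard $\rho^\sigma(\omega)$ as an element of $M_{d_\sigma}=M_{d_\sigma}(\mathbb C)$. Let $E$ be an operator space (complete), and let $S_n^2(E)$ be the $E$-valued Schatten class, normed by $\|x\|_{S_n^2(E)}=\inf\{\|a\|_{S_n^4}\|y\|_{M_n(E)}\|b\|_{S_n^4}: x=ayb\}$. For a finite set $\Sigma_0\subset\Sigma$ let $\mathcal L_E^2(\Sigma_0)=\prod_{\sigma\in\Sigma_0}M_{d_\sigma}\otimes E$ with the norm $\big(\sum_{\sigma\in\Sigma_0} d_\sigma\|A^\sigma\|^2_{S^2_{d_\sigma}(E)}\big)^{1/2}$, and let $\mathcal R_E^2(\Sigma_0)=\mathrm{span}\{\rho^\sigma_{ij}:\sigma\in\Sigma_0\}\otimes E$, a subspace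 of $L_E^2(\Omega)$. Both carry their natural operator space structures: $S_n^2(L_E^2(\Omega))=L^2(\Omega;S_n^2(E))$, $S_n^2(\mathcal L_E^2(\Sigma_0))$ is normed by $\big(\sum_\sigma d_\sigma\|A^\sigma\|^2_{S^2_{nd_\sigma}(E)}\big)^{1/2}$, and in both cases $\|x\|_{M_n(V)}=\sup\{\|axb\|_{S_n^2(V)}:\|a\|_{S_n^4},\|b\|_{S_n^4}\le1\}$. Put $$\mathcal F^{-1}(A)(\omega)=\sum_{\sigma\in\Sigma_0}d_\sigma\,\mathrm{tr}(A^\sigma\rho^\sigma(\omega)),\qquad \mathcal F(f)^\sigma=\int_\Omega f(\omega)\,\rho^\sigma(\omega)^*\,d\mu(\omega).$$ The space $E$ has $\mathcal R$-type $2$ if the completely bounded norms of $\mathcal F^{-1}:\mathcal L_E^2(\Sigma_0)\to \mathcal R_E^2(\Sigma_0)$ are bounded uniformly in the finite sets $\Sigma_0\subset\Sigma$, and $\mathcal R$-cotype $2$ if the same holds for $\mathcal F:\mathcal R_E^2(\Sigma_0)\to\mathcal L_E^2(\Sigma_0)$. Then: 1. If $E$ has $\mathcal R$-type $2$, then its underlying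 Banach space has Rademacher type $2$: there is a constant $C$ such that, for all $n$ and $x_1,\dots,x_n\in E$, $$\Big(\mathbb E\Big\|\sum_{k=1}^n\varepsilon_kx_k\Big\|^2\Big)^{1/2}\le C\Big(\sum_{k=1}^n\|x_k\|^2\Big)^{1/2}.$$ 2. If $E$ has $\mathcal R$-cotype $2$, then its underlying Banach space has Rademacher cotype $2$: there is a constant $C$ such that, for all $n$ and $x_1,\dots,x_n\in E$, $$\Big(\sum_{k=1}^n\|x_k\|^2\Big)^{1/2}\le C\Big(\mathbb E\Big\|\sum_{k=1}^n\varepsilon_kx_k\Big\|^2\Big)^{1/2}.$$ Here $\varepsilon_1,\dots,\varepsilon_n$ are independent signs with $P(\varepsilon_k=\pm1)=1/2$. -/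

import Mathlib

open MeasureTheory ProbabilityTheory
open scoped NNReal ENNReal Matrix

noncomputable section

namespace QuantizedSystem

/-! ## Scalar matrices -/

/-- The operator norm of a rectangular complex matrix, acting between Hilbert spaces
`ℂⁿ → ℂᵐ`. -/
def opNorm {m n : ℕ} (a : Matrix (Fin m) (Fin n) ℂ) : ℝ :=
  ‖LinearMap.toContinuousLinearMap (Matrix.toEuclideanLin a)‖

/-- The Schatten `4`-norm `‖a‖_{S_n^4} = (tr |a|⁴)^{1/4}`, with `|a|² = a* a`. -/
def schattenFour {n : ℕ} (a : Matrix (Fin n) (Fin n) ℂ) : ℝ :=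
  (((aᴴ * a) * (aᴴ * a)).trace.re) ^ (1 / 4 : ℝ)

/-- The product `a · x · b` of a matrix `x` with entries in a complex vector space by scalar
matrices on both sides. -/
def biMul {V : Type*} [AddCommGroup V] [Module ℂ V] {m n : ℕ}
    (a : Matrix (Fin n) (Fin m) ℂ) (x : Matrix (Fin m) (Fin m) V)
    (b : Matrix (Fin m) (Fin n) ℂ) : Matrix (Fin n) (Fin n) V :=
  fun i j => ∑ k, ∑ l, (a i k * b l j) • x k l

/-- The block diagonal sum `x ⊕ y`. -/
def diagSum {V : Type*} [AddCommGroup V] {m n : ℕ}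
    (x : Matrix (Fin m) (Fin m) V) (y : Matrix (Fin n) (Fin n) V) :
    Matrix (Fin (m + n)) (Fin (m + n)) V :=
  (Matrix.fromBlocks x 0 0 y).submatrix finSumFinEquiv.symm finSumFinEquiv.symm

/-! ## Operator spaces -/

/-- An operator space structure on a normed space `E`: a norm on every `M_n(E)`, extending the
norm of `E = M_1(E)`, subject to Ruan's axioms. The underlying Banach space of the operator
space is `E` itself. -/
class OperatorSpace (E : Type*) [NormedAddCommGroup E] [NormedSpace ℂ E] where
  /-- the norm of `M_n(E)` -/
  matNorm : (n : ℕ) → Matrix (Fin n) (Fin n) E → ℝ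
  matNorm_one : ∀ x : E, matNorm 1 (Matrix.of fun _ _ => x) = ‖x‖
  matNorm_add_le : ∀ (n : ℕ) (x y : Matrix (Fin n) (Fin n) E),
    matNorm n (x + y) ≤ matNorm n x + matNorm n y
  matNorm_smul : ∀ (n : ℕ) (c : ℂ) (x : Matrix (Fin n) (Fin n) E),
    matNorm n (c • x) = ‖c‖ * matNorm n x
  eq_zero_of_matNorm : ∀ (n : ℕ) (x : Matrix (Fin n) (Fin n) E), matNorm n x = 0 → x = 0
  matNorm_diagSum : ∀ (m n : ℕ) (x : Matrix (Fin m) (Fin m) E) (y : Matrix (Fin n) (Fin n) E),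
    matNorm (m + n) (diagSum x y) = max (matNorm m x) (matNorm n y)
  matNorm_biMul_le : ∀ (m n : ℕ) (a : Matrix (Fin n) (Fin m) ℂ)
    (x : Matrix (Fin m) (Fin m) E) (b : Matrix (Fin m) (Fin n) ℂ),
    matNorm n (biMul a x b) ≤ opNorm a * matNorm m x * opNorm b

section VectorValued

variable {E : Type*} [NormedAddCommGroup E] [NormedSpace ℂ E] [OperatorSpace E]

/-- The norm of the `E`-valued Schatten class `S_n^2(E)`:
`‖x‖ = inf ‖a‖_{S_n^4} ‖y‖_{M_n(E)} ‖b‖_{S_n^4}` over all factorizations `x = a · y · b`. -/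
def schattenTwo (n : ℕ) (x : Matrix (Fin n) (Fin n) E) : ℝ≥0∞ :=
  ⨅ (a : Matrix (Fin n) (Fin n) ℂ) (y : Matrix (Fin n) (Fin n) E)
    (b : Matrix (Fin n) (Fin n) ℂ) (_ : biMul a y b = x),
    ENNReal.ofReal (schattenFour a * OperatorSpace.matNorm n y * schattenFour b)

/-- The identification `M_n(M_d(E)) = M_{nd}(E)`. -/
def flatten {n d : ℕ} (x : Matrix (Fin n) (Fin n) (Matrix (Fin d) (Fin d) E)) :
    Matrix (Fin (n * d)) (Fin (n * d)) E :=
  fun p q => x (finProdFinEquiv.symm p).1 (finProdFinEquiv.symm q).1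
    (finProdFinEquiv.symm p).2 (finProdFinEquiv.symm q).2

/-! ## Operator space structure of vector-valued `L²`-spaces

The natural operator space structure of an `E`-valued `L²`-space `V` is recorded by the norms of
the spaces `S_n^2(V)`, which are given by the Fubini identities
`S_n^2(L_E^2(Ω)) = L^2(Ω; S_n^2(E))` and `S_n^2(S_d^2(E)) = S_{nd}^2(E)`. They determine the norms
of the spaces `M_n(V)` by `‖x‖_{M_n(V)} = sup ‖a · x · b‖_{S_n^2(V)}`, where `a` and `b` range
over the unit ball of `S_n^4`. -/

/-- The norm of `M_n(V)`, given the norms `s n` of the spaces `S_n^2(V)`. -/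
def matNormOf {V : Type*} [AddCommGroup V] [Module ℂ V]
    (s : (n : ℕ) → Matrix (Fin n) (Fin n) V → ℝ≥0∞) (n : ℕ)
    (x : Matrix (Fin n) (Fin n) V) : ℝ≥0∞ :=
  ⨆ (a : Matrix (Fin n) (Fin n) ℂ) (b : Matrix (Fin n) (Fin n) ℂ)
    (_ : schattenFour a ≤ 1) (_ : schattenFour b ≤ 1), s n (biMul a x b)

/-- The norm of `S_n^2(𝓛_E^2(S))` for a finite family `d` of positive integers, where
`𝓛_E^2(S) = ∏ M_{d_s} ⊗ E` has the norm `(∑ d_s ‖A^s‖²_{S_{d_s}^2(E)})^{1/2}`. -/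
def coeffSchatten {S : Type*} [Fintype S] (d : S → ℕ) (n : ℕ)
    (A : Matrix (Fin n) (Fin n) ((s : S) → Matrix (Fin (d s)) (Fin (d s)) E)) : ℝ≥0∞ :=
  (∑ s, (d s : ℝ≥0∞) * schattenTwo (n * d s) (flatten (Matrix.of fun i j => A i j s)) ^ 2) ^ (1 / 2 : ℝ)

/-- The norm of `M_n(𝓛_E^2(S))`. -/
def coeffMatNorm {S : Type*} [Fintype S] (d : S → ℕ) :
    (n : ℕ) → Matrix (Fin n) (Fin n) ((s : S) → Matrix (Fin (d s)) (Fin (d s)) E) → ℝ≥0∞ :=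
  matNormOf (coeffSchatten d)

variable {Ω : Type*} [MeasurableSpace Ω]

/-- The norm of `S_n^2(L_E^2(Ω)) = L^2(Ω; S_n^2(E))`. -/
def funSchatten (μ : Measure Ω) (n : ℕ) (f : Matrix (Fin n) (Fin n) (Ω → E)) : ℝ≥0∞ :=
  (∫⁻ ω, schattenTwo n (Matrix.of fun i j => f i j ω) ^ 2 ∂μ) ^ (1 / 2 : ℝ)

/-- The norm of `M_n(L_E^2(Ω))`. -/
def funMatNorm (μ : Measure Ω) : (n : ℕ) → Matrix (Fin n) (Fin n) (Ω → E) → ℝ≥0∞ :=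
  matNormOf (funSchatten μ)

end VectorValued

/-- The completely bounded norm of a map `u` on a subspace `D` of `V` with values in `W`, for
matrix norms `NV` and `NW`: the least `K` such that `‖(u x_{ij})‖_{M_n(W)} ≤ K ‖x‖_{M_n(V)}` for
all `n` and all `x` in `M_n(D)`; it is `∞` if there is no such `K`. -/
def cbNorm {V W : Type*} [AddCommGroup V] [Module ℂ V]
    (NV : (n : ℕ) → Matrix (Fin n) (Fin n) V → ℝ≥0∞)
    (NW : (n : ℕ) → Matrix (Fin n) (Fin n) W → ℝ≥0∞) (D : Submodule ℂ V) (u : V → W) : ℝ≥0∞ :=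
  ⨅ (K : ℝ≥0) (_ : ∀ (n : ℕ) (x : Matrix (Fin n) (Fin n) V), (∀ i j, x i j ∈ D) →
    NW n (x.map u) ≤ K * NV n x), (K : ℝ≥0∞)

/-! ## Riesz type 2 and cotype 2 with respect to a system of matrix-valued functions -/

section System

variable (E : Type*) [NormedAddCommGroup E] [NormedSpace ℂ E]
  {Ω : Type*} [MeasurableSpace Ω] {S : Type*} {d : S → ℕ}

/-- The transform `(𝓕 f)^s = ∫ f(ω) φ^s(ω)* dμ(ω)`. -/
def transform (μ : Measure Ω) (φ : (s : S) → Ω → Matrix (Fin (d s)) (Fin (d s)) ℂ) (f : Ω → E) :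
    (s : S) → Matrix (Fin (d s)) (Fin (d s)) E :=
  fun s i j => ∫ ω, ((φ s ω)ᴴ i j) • f ω ∂μ

/-- The inverse transform `(𝓕⁻¹ A)(ω) = ∑_s d_s tr(A^s φ^s(ω))`. -/
def invTransform [Fintype S] (φ : (s : S) → Ω → Matrix (Fin (d s)) (Fin (d s)) ℂ)
    (A : (s : S) → Matrix (Fin (d s)) (Fin (d s)) E) : Ω → E :=
  fun ω => ∑ s, (d s : ℂ) • ∑ i, ∑ j, φ s ω j i • A s i j

/-- The space `span {φ_{ij}^s} ⊗ E` of `E`-valued functions. -/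
def polynomials (φ : (s : S) → Ω → Matrix (Fin (d s)) (Fin (d s)) ℂ) : Submodule ℂ (Ω → E) :=
  Submodule.span ℂ {f | ∃ (s : S) (i j : Fin (d s)) (e : E), f = fun ω => φ s ω i j • e}

variable [OperatorSpace E]

/-- The constant `𝓚_{12}(E, φ)`: the supremum, over the finite sets `S₀` of indices, of the cb
norm of `𝓕⁻¹ : 𝓛_E^2(S₀) → L_E^2(Ω)`. -/
def typeConst (μ : Measure Ω) (φ : (s : S) → Ω → Matrix (Fin (d s)) (Fin (d s)) ℂ) : ℝ≥0∞ :=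
  ⨆ S₀ : Finset S, cbNorm (coeffMatNorm fun s : S₀ => d s) (funMatNorm μ) ⊤
    (invTransform E fun s : S₀ => φ s)

/-- The constant `𝓚_{22}(E, φ)`: the supremum, over the finite sets `S₀` of indices, of the cb
norm of `𝓕 : span {φ_{ij}^s : s ∈ S₀} ⊗ E → 𝓛_E^2(S₀)`, the domain being normed as a subspace of
`L_E^2(Ω)`. -/
def cotypeConst (μ : Measure Ω) (φ : (s : S) → Ω → Matrix (Fin (d s)) (Fin (d s)) ℂ) : ℝ≥0∞ :=
  ⨆ S₀ : Finset S, cbNorm (funMatNorm μ) (coeffMatNorm fun s : S₀ => d s)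
    (polynomials E fun s : S₀ => φ s) (transform E μ fun s : S₀ => φ s)

/-- `E` has Riesz type `2` with respect to the system `φ`. -/
def HasRieszTypeTwo (μ : Measure Ω) (φ : (s : S) → Ω → Matrix (Fin (d s)) (Fin (d s)) ℂ) : Prop :=
  typeConst E μ φ < ∞

/-- `E` has Riesz cotype `2` with respect to the system `φ`. -/
def HasRieszCotypeTwo (μ : Measure Ω) (φ : (s : S) → Ω → Matrix (Fin (d s)) (Fin (d s)) ℂ) :
    Prop :=
  cotypeConst E μ φ < ∞

end System

/-! ## The quantized Rademacher system -/

/-- The orthogonal group `O(n)` carries its Borel `σ`-algebra. -/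
instance orthogonalMeasurableSpace (n : ℕ) :
    MeasurableSpace (Matrix.orthogonalGroup (Fin n) ℝ) := borel _

instance orthogonalBorelSpace (n : ℕ) : BorelSpace (Matrix.orthogonalGroup (Fin n) ℝ) := ⟨rfl⟩

/-- A family of independent random orthogonal matrices, each distributed according to the
normalized Haar measure of its orthogonal group (the law of a random variable on a probability
space is normalized). -/
structure IsQuantizedRademacher {Ω : Type*} [MeasurableSpace Ω] (μ : Measure Ω) {S : Type*}
    {d : S → ℕ} (ρ : (s : S) → Ω → Matrix.orthogonalGroup (Fin (d s)) ℝ) : Prop where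
  measurable : ∀ s, Measurable (ρ s)
  indep : iIndepFun ρ μ
  haar : ∀ s, (μ.map (ρ s)).IsHaarMeasure

/-- Orthogonal matrices regarded as complex matrices. -/
def complexify {Ω S : Type*} {d : S → ℕ}
    (ρ : (s : S) → Ω → Matrix.orthogonalGroup (Fin (d s)) ℝ) (s : S) (ω : Ω) :
    Matrix (Fin (d s)) (Fin (d s)) ℂ :=
  (ρ s ω : Matrix (Fin (d s)) (Fin (d s)) ℝ).map Complex.ofReal

/-! ## Classical Rademacher type 2 and cotype 2 -/

/-- The mean `𝔼 ‖∑ ε_k x_k‖²` over independent uniformly distributed signs `ε_k = ±1`. -/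
def rademacherMean {E : Type*} [NormedAddCommGroup E] {n : ℕ} (x : Fin n → E) : ℝ :=
  (∑ ε : Fin n → ℤˣ, ‖∑ k, (ε k : ℤ) • x k‖ ^ 2) / 2 ^ n

/-- Rademacher type `2`. -/
def HasRademacherTypeTwo (E : Type*) [NormedAddCommGroup E] : Prop :=
  ∃ C : ℝ, ∀ (n : ℕ) (x : Fin n → E), √(rademacherMean x) ≤ C * √(∑ k, ‖x k‖ ^ 2)

/-- Rademacher cotype `2`. -/
def HasRademacherCotypeTwo (E : Type*) [NormedAddCommGroup E] : Prop :=
  ∃ C : ℝ, ∀ (n : ℕ) (x : Fin n → E), √(∑ k, ‖x k‖ ^ 2) ≤ C * √(rademacherMean x)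

end QuantizedSystem

end

namespace QuantizedSystem

/-! ### Rademacher averages, contraction and cotype estimates for disjoint blocks -/

section RademacherAverages

/-! One entry of each random matrix suffices. Let `g_s = √(d s) * ρ^s_{00}`. The cb bounds are used
only at matrix level one: for type, on coefficients with the single diagonal entry `(√(d s))⁻¹ •
y_s`; for cotype, on the functions `∑ g_s y_s`, of whose transform only the corner entries are kept.
The Schatten norm of a matrix dominates each entry, with equality for one diagonal entry, so type or
cotype 2 follows with `g_s` in place of signs (`HasRieszTypeTwo.exists_sqrt_le`,
`HasRieszCotypeTwo.exists_sqrt_le`). The `g_s` are independent and symmetric with second moment 1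
and fourth moment at most 3, but have no common sup bound when the `d s` are unbounded.

Type: these moments give `E|g_s| ≥ 1/8`. Symmetry allows extra random signs, and Jensen with the
contraction principle bounds the Rademacher mean by 64 times the mean with `g_s`
(`rademacherMean_le_integral_norm_sq`).

Cotype: the mean with `g_s` must be bounded above by the Rademacher mean, which can fail in a
general space under moment conditions alone. The cotype being proved is therefore used to prove
itself. For at most `N` nonzero vectors cotype holds with constant `N`. If it holds with constant
`K`, coefficients supported on events of probability at most `1/(2M)` have mean at most `4K/M` times
the Rademacher mean: in `M` independent copies, the parts where only one copy is active form
disjoint blocks, to which cotype applies. Summing over dyadic levels of `|g_s|`, where the fourth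
moment makes large values rare, bounds the tail above `2^(a+1)` by a multiple of `K / 4^a`
(`CotypeBound.integral_weightedMean_tail_le`). For large `a` the constant improves from `K` to `A +
K/2`, with `A` independent of `N`, so the optimal constants are bounded uniformly in `N`
(`CotypeBound.of_improvement`). -/

theorem rademacherMean_nonneg {E : Type*} [NormedAddCommGroup E] {n : ℕ} (x : Fin n → E) :
    0 ≤ rademacherMean x := by
  unfold rademacherMean; positivity

/-- The estimate of cotype `2` with constant `K` for families with at most `N` nonzero
members. -/
def CotypeBound (E : Type*) [NormedAddCommGroup E] (N : ℕ) (K : ℝ) : Prop :=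
  ∀ (m : ℕ) (x : Fin m → E), {k | x k ≠ 0}.ncard ≤ N →
    ∑ k, ‖x k‖ ^ 2 ≤ K * rademacherMean x

theorem CotypeBound.mono {E : Type*} [NormedAddCommGroup E] {N : ℕ} {K K' : ℝ}
    (h : CotypeBound E N K) (hK : K ≤ K') :
    CotypeBound E N K' := fun m x hx =>
  (h m x hx).trans (mul_le_mul_of_nonneg_right hK (rademacherMean_nonneg x))

variable {E : Type*} [NormedAddCommGroup E] [NormedSpace ℝ E] {n : ℕ}

/-- The Rademacher mean of the vectors `a k • x k`, as a function of the coefficients. -/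
noncomputable def weightedMean (x : Fin n → E) (a : Fin n → ℝ) : ℝ :=
  rademacherMean fun k => a k • x k

theorem weightedMean_eq (x : Fin n → E) (a : Fin n → ℝ) :
    weightedMean x a = (∑ ε : Fin n → ℤˣ, ‖∑ k, (((ε k : ℤ) : ℝ) * a k) • x k‖ ^ 2) / 2 ^ n := by
  unfold weightedMean rademacherMean
  congr 1
  refine Finset.sum_congr rfl fun ε _ => ?_
  congr 2
  refine Finset.sum_congr rfl fun k _ => ?_
  rw [mul_smul, Int.cast_smul_eq_zsmul]

theorem weightedMean_one (x : Fin n → E) : weightedMean x 1 = rademacherMean x := by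
  simp [weightedMean]

theorem weightedMean_nonneg (x : Fin n → E) (a : Fin n → ℝ) : 0 ≤ weightedMean x a :=
  rademacherMean_nonneg _

theorem continuous_weightedMean (x : Fin n → E) : Continuous (weightedMean x) := by
  have : weightedMean x = fun a : Fin n → ℝ =>
      (∑ ε : Fin n → ℤˣ, ‖∑ k, (((ε k : ℤ) : ℝ) * a k) • x k‖ ^ 2) / 2 ^ n :=
    funext fun a => weightedMean_eq x a
  rw [this]
  fun_prop

theorem convexOn_weightedMean (x : Fin n → E) : ConvexOn ℝ Set.univ (weightedMean x) := by
  have key (ε : Fin n → ℤˣ) : ConvexOn ℝ Set.univ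
      fun a : Fin n → ℝ => ‖∑ k, (((ε k : ℤ) : ℝ) * a k) • x k‖ ^ 2 := by
    let T : (Fin n → ℝ) →ₗ[ℝ] E :=
      ∑ k, (LinearMap.toSpanSingleton ℝ E (x k)) ∘ₗ
        ((((ε k : ℤ) : ℝ)) • (LinearMap.proj k : (Fin n → ℝ) →ₗ[ℝ] ℝ))
    have h := (convexOn_univ_norm (E := E)).pow (fun _ _ => norm_nonneg _) 2
    have h2 := h.comp_linearMap T
    simpa [T, Function.comp_def] using h2
  have hs : ConvexOn ℝ Set.univ
      (∑ ε : Fin n → ℤˣ, fun a : Fin n → ℝ => ‖∑ k, (((ε k : ℤ) : ℝ) * a k) • x k‖ ^ 2) := by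
    classical
    refine Finset.sum_induction _ (ConvexOn ℝ Set.univ) (fun f g hf hg => hf.add hg)
      (convexOn_const 0 convex_univ) fun ε _ => key ε
  have h3 := hs.smul (c := ((2 : ℝ) ^ n)⁻¹) (by positivity)
  have heq : weightedMean x = fun a => ((2 : ℝ) ^ n)⁻¹ •
      (∑ ε : Fin n → ℤˣ, fun a : Fin n → ℝ => ‖∑ k, (((ε k : ℤ) : ℝ) * a k) • x k‖ ^ 2) a := by
    funext a
    rw [weightedMean_eq, div_eq_inv_mul]
    simp
  rw [heq]
  exact h3

/-- The substitution `ε ↦ ε * δ` permutes the sign vectors. -/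
theorem weightedMean_mul_sign (x : Fin n → E) (a : Fin n → ℝ) (δ : Fin n → ℤˣ) :
    weightedMean x (fun k => ((δ k : ℤ) : ℝ) * a k) = weightedMean x a := by
  rw [weightedMean_eq, weightedMean_eq]
  congr 1
  refine Fintype.sum_equiv (Equiv.mulRight δ) _ _ fun ε => ?_
  simp [mul_assoc]

theorem exists_sign_mul_abs (r : ℝ) : ∃ δ : ℤˣ, r = ((δ : ℤ) : ℝ) * |r| := by
  rcases le_total 0 r with h | h
  · exact ⟨1, by simp [abs_of_nonneg h]⟩
  · exact ⟨-1, by simp [abs_of_nonpos h]⟩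

theorem weightedMean_abs (x : Fin n → E) (a : Fin n → ℝ) :
    weightedMean x (fun k => |a k|) = weightedMean x a := by
  choose δ hδ using fun k => exists_sign_mul_abs (a k)
  rw [← weightedMean_mul_sign x _ δ]
  congr 1
  ext k
  exact (hδ k).symm

/-- The contraction principle, for coefficients in `[-1, 1]`. -/
theorem weightedMean_le_rademacherMean (x : Fin n → E) (a : Fin n → ℝ) (ha : ∀ k, |a k| ≤ 1) :
    weightedMean x a ≤ rademacherMean x := by
  -- The cube is the convex hull of its sign vectors. A convex function is dominated by its value at
  -- some vertex, and here all vertices have the same value.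
  have hmem : a ∈ convexHull ℝ (Set.univ.pi fun _ : Fin n => ({-1, 1} : Set ℝ)) := by
    rw [convexHull_pi]
    intro k _
    rw [convexHull_pair, segment_eq_Icc (by norm_num)]
    exact abs_le.1 (ha k)
  obtain ⟨b, hb, hab⟩ :=
    (convexOn_weightedMean x).exists_ge_of_mem_convexHull (Set.subset_univ _) hmem
  refine hab.trans (le_of_eq ?_)
  rw [← weightedMean_abs, ← weightedMean_one]
  congr 1
  ext k
  rcases hb k (Set.mem_univ _) with h | h
  · simp [h]
  · rw [Set.mem_singleton_iff] at h
    simp [h]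

/-- The contraction principle. -/
theorem weightedMean_mono (x : Fin n → E) {a b : Fin n → ℝ} (hab : ∀ k, |a k| ≤ |b k|) :
    weightedMean x a ≤ weightedMean x b := by
  -- Where `b k = 0` the quotient is 0 by convention, which is harmless because `a k` then vanishes
  -- too.
  have h := weightedMean_le_rademacherMean (fun k => b k • x k) (fun k => a k / b k) fun k => by
    rw [abs_div]
    exact div_le_one_of_le₀ (hab k) (abs_nonneg _)
  refine le_trans (le_of_eq ?_) h
  unfold weightedMean
  congr 1
  ext k
  rw [smul_smul]
  by_cases hb : b k = 0
  · have : a k = 0 := by simpa [hb] using hab k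
    simp [this]
  · rw [div_mul_cancel₀ _ hb]

theorem weightedMean_const_mul (x : Fin n → E) (c : ℝ) (a : Fin n → ℝ) :
    weightedMean x (fun k => c * a k) = c ^ 2 * weightedMean x a := by
  rw [weightedMean_eq, weightedMean_eq, ← mul_div_assoc, Finset.mul_sum]
  congr 1
  refine Finset.sum_congr rfl fun ε _ => ?_
  have : ∑ k, (((ε k : ℤ) : ℝ) * (c * a k)) • x k = c • ∑ k, (((ε k : ℤ) : ℝ) * a k) • x k := by
    rw [Finset.smul_sum]
    refine Finset.sum_congr rfl fun k _ => ?_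
    rw [smul_smul]; ring_nf
  rw [this, norm_smul, mul_pow, Real.norm_eq_abs, sq_abs]

theorem weightedMean_le_sq_mul (x : Fin n → E) {c : ℝ} {a b : Fin n → ℝ}
    (h : ∀ k, |a k| ≤ |c * b k|) : weightedMean x a ≤ c ^ 2 * weightedMean x b :=
  (weightedMean_mono x h).trans_eq (weightedMean_const_mul x c b)

theorem weightedMean_add_le (x : Fin n → E) (a b : Fin n → ℝ) :
    weightedMean x (a + b) ≤ 2 * weightedMean x a + 2 * weightedMean x b := by
  simp only [weightedMean_eq]
  rw [← mul_div_assoc, ← mul_div_assoc, ← add_div, Finset.mul_sum, Finset.mul_sum,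
    ← Finset.sum_add_distrib]
  gcongr with ε
  have : ∑ k, (((ε k : ℤ) : ℝ) * (a + b) k) • x k
      = ∑ k, (((ε k : ℤ) : ℝ) * a k) • x k + ∑ k, (((ε k : ℤ) : ℝ) * b k) • x k := by
    rw [← Finset.sum_add_distrib]
    refine Finset.sum_congr rfl fun k _ => ?_
    rw [← add_smul, Pi.add_apply, mul_add]
  rw [this]
  set u := ∑ k, (((ε k : ℤ) : ℝ) * a k) • x k
  set v := ∑ k, (((ε k : ℤ) : ℝ) * b k) • x k
  nlinarith [norm_add_le u v, norm_nonneg (u + v), norm_nonneg u, norm_nonneg v,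
    sq_nonneg (‖u‖ - ‖v‖)]

theorem norm_units_smul (δ : ℤˣ) (v : E) : ‖((δ : ℤ) : ℝ) • v‖ = ‖v‖ := by
  rcases Int.units_eq_one_or δ with h | h <;> simp [h]

theorem abs_units (δ : ℤˣ) : |((δ : ℤ) : ℝ)| = 1 := by
  rcases Int.units_eq_one_or δ with h | h <;> simp [h]

theorem card_signs (n : ℕ) : (Finset.univ : Finset (Fin n → ℤˣ)).card = 2 ^ n := by
  simp

/-- Contraction onto a single coordinate. -/
theorem norm_sq_le_rademacherMean (x : Fin n → E) (k : Fin n) :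
    ‖x k‖ ^ 2 ≤ rademacherMean x := by
  classical
  refine le_trans (le_of_eq ?_) (weightedMean_le_rademacherMean x (Pi.single k 1) fun l => ?_)
  · rw [weightedMean_eq]
    have : ∀ ε : Fin n → ℤˣ,
        ‖∑ l, (((ε l : ℤ) : ℝ) * (Pi.single k 1 : Fin n → ℝ) l) • x l‖ ^ 2 = ‖x k‖ ^ 2 := by
      intro ε
      rw [Finset.sum_eq_single k]
      · simp [norm_units_smul]
      · intro l _ hl
        simp [hl]
      · simp
    rw [Finset.sum_congr rfl fun ε _ => this ε, Finset.sum_const, card_signs, nsmul_eq_mul]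
    field_simp
    push_cast
    ring
  · by_cases h : l = k
    · subst h; simp
    · simp [h]

/-- The a priori bound that starts the bootstrap: at most `N` nonzero summands, each at most the
mean. -/
theorem cotypeBound_self (N : ℕ) : CotypeBound E N N := by
  classical
  intro m x hx
  rw [Set.ncard_eq_toFinset_card', Set.toFinset_ofPred] at hx
  rw [← Finset.sum_filter_of_ne (p := fun k => x k ≠ 0)
    (fun k _ h => by contrapose! h; simp [h])]
  refine (Finset.sum_le_card_nsmul _ _ _ fun k _ => norm_sq_le_rademacherMean x k).trans ?_
  rw [nsmul_eq_mul]
  gcongr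
  exact rademacherMean_nonneg x

/-- The infimum `I` of the admissible constants satisfies `I ≤ A + I/2`, so `I ≤ 2A`. The extra 1
avoids showing that the infimum is attained. -/
theorem CotypeBound.of_improvement {N : ℕ} {A : ℝ} (hA : 0 ≤ A)
    (h : ∀ K, 0 ≤ K → CotypeBound E N K → CotypeBound E N (A + K / 2)) :
    CotypeBound E N (2 * A + 1) := by
  set V : Set ℝ := {K | 0 ≤ K ∧ CotypeBound E N K} with hV
  have hne : V.Nonempty := ⟨N, Nat.cast_nonneg N, cotypeBound_self N⟩
  have hbd : BddBelow V := ⟨0, fun K hK => hK.1⟩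
  have h1 : 2 * (sInf V - A) ≤ sInf V := by
    refine le_csInf hne fun K hK => ?_
    have : sInf V ≤ A + K / 2 := csInf_le hbd ⟨by linarith [hK.1], h K hK.1 hK.2⟩
    linarith
  obtain ⟨K, hK, hlt⟩ := exists_lt_of_csInf_lt hne (show sInf V < 2 * A + 1 by linarith)
  exact hK.2.mono hlt.le

/-- A cotype estimate applied to sums over disjoint blocks. -/
theorem CotypeBound.sum_weightedMean_le {N : ℕ} {K : ℝ} (hK : 0 ≤ K) (h : CotypeBound E N K)
    (x : Fin n → E) (hx : {k | x k ≠ 0}.ncard ≤ N) {M : ℕ} (c : Fin M → Fin n → ℝ)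
    (hc : ∀ j k, |c j k| ≤ 1) (hdisj : ∀ k i j, c i k ≠ 0 → c j k ≠ 0 → i = j) :
    ∑ j, weightedMean x (c j) ≤ K * rademacherMean x := by
  classical
  -- Disjointness leaves at most one nonzero term, so signed sums of the blocks are again
  -- contractions.
  have hsum (δ : Fin M → ℤˣ) (k : Fin n) : |∑ j, ((δ j : ℤ) : ℝ) * c j k| ≤ 1 := by
    by_cases hj : ∃ j, c j k ≠ 0
    · obtain ⟨j, hj⟩ := hj
      rw [Finset.sum_eq_single j]
      · rw [abs_mul, abs_units, one_mul]; exact hc j k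
      · intro i _ hij
        have : c i k = 0 := by by_contra hi; exact hij (hdisj k i j hi hj)
        simp [this]
      · simp
    · push Not at hj
      simp [hj]
  -- With the signs `ε` frozen, cotype is applied to the block sums with fresh signs `δ`; averaging
  -- over `ε` follows.
  have hblock (ε : Fin n → ℤˣ) :
      ∑ j, ‖∑ k, (((ε k : ℤ) : ℝ) * c j k) • x k‖ ^ 2 ≤
        K * ((∑ δ : Fin M → ℤˣ,
          ‖∑ k, (((ε k : ℤ) : ℝ) * ∑ j, ((δ j : ℤ) : ℝ) * c j k) • x k‖ ^ 2) / 2 ^ M) := by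
    set y : Fin M → E := fun j => ∑ k, (((ε k : ℤ) : ℝ) * c j k) • x k with hy
    have hcard : {j | y j ≠ 0}.ncard ≤ N := by
      refine le_trans ?_ hx
      -- Each nonzero block sum involves a nonzero vector, and disjoint blocks involve different
      -- ones. Hence `N` bounds the number of nonzero block sums, however large `M` is.
      have hex : ∀ j, y j ≠ 0 → ∃ k, c j k ≠ 0 ∧ x k ≠ 0 := by
        intro j hj
        by_contra! hcon
        apply hj
        refine Finset.sum_eq_zero fun k _ => ?_
        by_cases hck : c j k = 0
        · simp [hck]
        · simp [hcon k hck]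
      rcases isEmpty_or_nonempty (Fin n) with hn | hn
      · have : {j | y j ≠ 0} = ∅ := by
          ext j
          simp only [Set.mem_ofPred_eq, Set.mem_empty_iff_false, iff_false]
          intro hj
          exact hn.elim (hex j hj).choose
        simp [this]
      choose! f hf using hex
      refine Set.ncard_le_ncard_of_injOn f (fun j hj => (hf j hj).2) ?_ (Set.toFinite _)
      intro i hi j hj hij
      exact hdisj (f i) i j (hf i hi).1 (by rw [hij]; exact (hf j hj).1)
    refine (h M y hcard).trans (le_of_eq ?_)
    unfold rademacherMean
    congr 2
    refine Finset.sum_congr rfl fun δ _ => ?_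
    congr 2
    simp only [hy, Finset.smul_sum, Finset.mul_sum, Finset.sum_smul]
    rw [Finset.sum_comm]
    refine Finset.sum_congr rfl fun k _ => Finset.sum_congr rfl fun j _ => ?_
    rw [← Int.cast_smul_eq_zsmul ℝ, smul_smul]
    congr 1
    ring
  calc ∑ j, weightedMean x (c j)
      = (∑ ε : Fin n → ℤˣ, ∑ j, ‖∑ k, (((ε k : ℤ) : ℝ) * c j k) • x k‖ ^ 2) / 2 ^ n := by
        simp only [weightedMean_eq]
        rw [← Finset.sum_div, Finset.sum_comm]
    _ ≤ (∑ ε : Fin n → ℤˣ, K * ((∑ δ : Fin M → ℤˣ,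
          ‖∑ k, (((ε k : ℤ) : ℝ) * ∑ j, ((δ j : ℤ) : ℝ) * c j k) • x k‖ ^ 2) / 2 ^ M)) / 2 ^ n := by
        gcongr with ε
        exact hblock ε
    _ = K * ((∑ δ : Fin M → ℤˣ, weightedMean x fun k => ∑ j, ((δ j : ℤ) : ℝ) * c j k) / 2 ^ M) := by
        simp only [weightedMean_eq]
        rw [← Finset.mul_sum, ← Finset.sum_div, ← Finset.sum_div, Finset.sum_comm]
        ring
    _ ≤ K * ((∑ δ : Fin M → ℤˣ, rademacherMean x) / 2 ^ M) := by
        gcongr with δ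
        exact weightedMean_le_rademacherMean x _ (hsum δ)
    _ = K * rademacherMean x := by
        rw [Finset.sum_const, card_signs, nsmul_eq_mul]
        push_cast
        field_simp

end RademacherAverages

/-! ### Random coefficients: rare events, tails and comparison with signs -/

section RandomCoefficients

variable {E : Type*} [NormedAddCommGroup E] [NormedSpace ℝ E] {n : ℕ}
  {Ω : Type*} [MeasurableSpace Ω]

theorem integrable_weightedMean (μ : Measure Ω) [IsFiniteMeasure μ] (x : Fin n → E)
    {h : Fin n → Ω → ℝ} (hm : ∀ k, Measurable (h k)) {B : ℝ} (hB : ∀ k ω, |h k ω| ≤ B) :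
    Integrable (fun ω => weightedMean x fun k => h k ω) μ := by
  refine Integrable.of_bound (C := B ^ 2 * weightedMean x 1) ?_ (ae_of_all _ fun ω => ?_)
  · exact ((continuous_weightedMean x).measurable.comp
      (measurable_pi_lambda _ hm)).aestronglyMeasurable
  · rw [Real.norm_of_nonneg (weightedMean_nonneg _ _)]
    refine weightedMean_le_sq_mul x fun k => ?_
    simpa using (hB k ω).trans (le_abs_self B)

/-- Jensen's inequality for random coefficients. -/
theorem weightedMean_integral_le (μ : Measure Ω) [IsProbabilityMeasure μ] (x : Fin n → E)
    {h : Fin n → Ω → ℝ} (hm : ∀ k, Measurable (h k)) {B : ℝ} (hB : ∀ k ω, |h k ω| ≤ B) :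
    weightedMean x (fun k => ∫ ω, h k ω ∂μ) ≤ ∫ ω, weightedMean x (fun k => h k ω) ∂μ := by
  have hi (k : Fin n) : Integrable (h k) μ :=
    Integrable.of_bound (hm k).aestronglyMeasurable B (ae_of_all _ fun ω => hB k ω)
  have hint : Integrable (fun ω k => h k ω) μ := Integrable.of_eval hi
  have hJ := (convexOn_weightedMean x).map_integral_le (μ := μ) (f := fun ω k => h k ω)
    (continuous_weightedMean x).continuousOn isClosed_univ (ae_of_all _ fun _ => Set.mem_univ _)
    hint (integrable_weightedMean μ x hm hB)
  convert hJ using 2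
  funext k
  rw [eval_integral hi]

/-- Under a cotype estimate, coefficients supported on rare events have a small mean. -/
theorem CotypeBound.integral_weightedMean_indicator_le {N : ℕ} {K : ℝ} (hK : 0 ≤ K)
    (h : CotypeBound E N K) (μ : Measure Ω) [IsProbabilityMeasure μ]
    (x : Fin n → E) (hx : {k | x k ≠ 0}.ncard ≤ N) (A : Fin n → Set Ω)
    (hA : ∀ k, MeasurableSet (A k)) {M : ℕ} (hM : 0 < M)
    (hp : ∀ k, μ.real (A k) ≤ 1 / (2 * M)) :
    ∫ ω, weightedMean x (fun k => (A k).indicator 1 ω) ∂μ ≤ 4 * K / M * rademacherMean x := by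
  classical
  obtain ⟨m, rfl⟩ := Nat.exists_eq_succ_of_ne_zero hM.ne'
  -- The number of copies is `m + 1`: one in which `A k` occurs, and `m` others that all avoid it.
  set Q : Fin n → Set (Fin m → Ω) := fun k => Set.univ.pi fun _ => (A k)ᶜ with hQ
  have hQm (k : Fin n) : MeasurableSet (Q k) := MeasurableSet.univ_pi fun _ => (hA k).compl
  set ν : Measure (Fin m → Ω) := Measure.pi fun _ => μ with hν
  -- Bernoulli's inequality: the other copies all avoid `A k` with probability at least `1 -
  -- m/(2(m+1)) ≥ 1/2`.
  have hQhalf (k : Fin n) : 1 / 2 ≤ ν.real (Q k) := by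
    have h1 : ν.real (Q k) = (1 - μ.real (A k)) ^ m := by
      rw [← probReal_compl_eq_one_sub (hA k)]
      simp [measureReal_def, hν, hQ, Measure.pi_pi, ENNReal.toReal_pow]
    have h0 : 0 ≤ μ.real (A k) := measureReal_nonneg
    have h2 := one_add_mul_le_pow (a := -μ.real (A k))
      (by linarith [measureReal_le_one (μ := μ) (s := A k)]) m
    have h3 : (m : ℝ) * μ.real (A k) ≤ 1 / 2 := by
      have hm1 : (0 : ℝ) < 2 * ((m.succ : ℕ) : ℝ) := by positivity
      have := (le_div_iff₀ hm1).1 (hp k)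
      push_cast at this
      nlinarith
    rw [h1]
    have : (1 : ℝ) + m * -μ.real (A k) ≤ (1 - μ.real (A k)) ^ m := by
      simpa [sub_eq_add_neg] using h2
    linarith
  have hind {X : Type _} (s : Set X) (y : X) : |s.indicator (1 : X → ℝ) y| ≤ 1 := by
    by_cases hy : y ∈ s <;> simp [hy]
  -- The formula is the same for all `j`; the dependence on the block enters through `e j`, which
  -- splits off copy `j`.
  let c : Fin (m + 1) → Fin n → Ω × (Fin m → Ω) → ℝ := fun _ k z =>
    (A k).indicator 1 z.1 * (Q k).indicator 1 z.2
  have hcm (j k) : Measurable (c j k) :=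
    ((measurable_one.indicator (hA k)).comp measurable_fst).mul
      ((measurable_one.indicator (hQm k)).comp measurable_snd)
  have hcb (j k z) : |c j k z| ≤ 1 := by
    rw [abs_mul]
    exact mul_le_one₀ (hind _ _) (abs_nonneg _) (hind _ _)
  let e : Fin (m + 1) → (Fin (m + 1) → Ω) ≃ᵐ Ω × (Fin m → Ω) := fun j =>
    MeasurableEquiv.piFinSuccAbove (fun _ => Ω) j
  have hmp (j : Fin (m + 1)) :
      MeasurePreserving (e j) (Measure.pi fun _ => μ) (μ.prod ν) :=
    measurePreserving_piFinSuccAbove (fun _ => μ) j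
  set J := ∫ ω, weightedMean x (fun k => (A k).indicator 1 ω) ∂μ with hJ
  have hone (j : Fin (m + 1)) :
      1 / 4 * J ≤ ∫ w, weightedMean x (fun k => c j k (e j w)) ∂(Measure.pi fun _ => μ) := by
    rw [(hmp j).integral_comp' (fun z => weightedMean x fun k => c j k z),
      integral_prod _ (integrable_weightedMean (μ.prod ν) x (hcm j) (hcb j)), hJ,
      ← integral_const_mul]
    refine integral_mono
      ((integrable_weightedMean μ x (fun k => measurable_one.indicator (hA k))
        fun k ω => hind _ _).const_mul _)
      (integrable_weightedMean (μ.prod ν) x (hcm j) (hcb j)).integral_prod_left fun ω => ?_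
    -- Jensen in the other copies replaces the indicator of `Q k` by its probability. Being at least
    -- `1/2`, it costs a factor 2 in the coefficients, hence 4 in the mean.
    have h1 := weightedMean_integral_le ν x (h := fun k r => c j k (ω, r))
      (fun k => (hcm j k).comp measurable_prodMk_left) (fun k r => hcb j k (ω, r))
    refine le_trans ?_ h1
    have h2 (k : Fin n) : ∫ r, c j k (ω, r) ∂ν = (A k).indicator 1 ω * ν.real (Q k) := by
      simp only [c]
      rw [integral_const_mul, integral_indicator_one (hQm k)]
    simp only [h2]
    have h3 : weightedMean x (fun k => (A k).indicator 1 ω) ≤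
        2 ^ 2 * weightedMean x (fun k => (A k).indicator 1 ω * ν.real (Q k)) := by
      refine weightedMean_le_sq_mul x fun k => ?_
      rw [mul_left_comm, abs_mul]
      refine le_mul_of_one_le_right (abs_nonneg _) ?_
      rw [abs_of_nonneg (by linarith [hQhalf k])]
      linarith [hQhalf k]
    linarith
  have hsum : ∑ j, ∫ w, weightedMean x (fun k => c j k (e j w)) ∂(Measure.pi fun _ => μ) ≤
      K * rademacherMean x := by
    have hi (j : Fin (m + 1)) : Integrable (fun w => weightedMean x fun k => c j k (e j w))
        (Measure.pi fun _ => μ) :=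
      integrable_weightedMean _ x (fun k => (hcm j k).comp (e j).measurable)
        fun k w => hcb j k (e j w)
    rw [← integral_finsetSum _ fun j _ => hi j]
    have hle (w : Fin (m + 1) → Ω) :
        ∑ j, weightedMean x (fun k => c j k (e j w)) ≤ K * rademacherMean x := by
      refine h.sum_weightedMean_le hK x hx (fun j k => c j k (e j w))
        (fun j k => hcb j k (e j w)) fun k i j hi hj => ?_
      -- Block `i` needs `w i ∈ A k`, while block `j` needs every copy other than `j` to avoid `A
      -- k`.
      by_contra hij
      obtain ⟨l, hl⟩ := Fin.exists_succAbove_eq hij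
      have h1 : w i ∈ A k := by
        by_contra hn
        refine hi ?_
        have h0 : (e i w).1 ∉ A k := hn
        simp [c, h0]
      have h2 : (e j w).2 ∈ Q k := by
        by_contra hn
        exact hj (by simp [c, hn])
      have h3 := h2 l (Set.mem_univ _)
      have h4 : (e j w).2 l = w i := by
        rw [← hl]; rfl
      rw [h4] at h3
      exact h3 h1
    calc _ ≤ ∫ _, K * rademacherMean x ∂(Measure.pi fun _ : Fin (m + 1) => μ) :=
          integral_mono (integrable_finsetSum _ fun j _ => hi j) (integrable_const _) hle
      _ = _ := by simp
  have htot : ((m.succ : ℕ) : ℝ) * (1 / 4 * J) ≤ K * rademacherMean x := by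
    refine le_trans ?_ hsum
    have := Finset.card_nsmul_le_sum Finset.univ _ _ fun j _ => hone j
    simpa [nsmul_eq_mul] using this
  have hpos : (0 : ℝ) < ((m.succ : ℕ) : ℝ) := by positivity
  rw [div_mul_eq_mul_div, le_div_iff₀ hpos]
  linarith

/-- Markov's inequality for the fourth power gives `3 / 16^(a+1)`, and `3/16 ≤ 1/4`. The bound has
the form `1/(2M)` with `M = 2 * 16^a`, as required for rare events. -/
theorem measureReal_lt_abs_le (μ : Measure Ω) [IsProbabilityMeasure μ] {g : Ω → ℝ}
    (hg : Measurable g) {B : ℝ} (hB : ∀ ω, |g ω| ≤ B) (h4 : ∫ ω, g ω ^ 4 ∂μ ≤ 3) (a : ℕ) :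
    μ.real {ω | 2 ^ (a + 1) < |g ω|} ≤ 1 / (2 * (2 * 16 ^ a : ℕ)) := by
  have hint : Integrable (fun ω => g ω ^ 4) μ := by
    refine Integrable.of_bound (hg.pow_const 4).aestronglyMeasurable (B ^ 4)
      (ae_of_all _ fun ω => ?_)
    rw [norm_pow, Real.norm_eq_abs]
    gcongr
    exact hB ω
  have h1 := mul_meas_ge_le_integral_of_nonneg (μ := μ) (f := fun ω => g ω ^ 4)
    (ae_of_all _ fun ω => by positivity) hint (16 ^ (a + 1))
  have h2 : μ.real {ω | 2 ^ (a + 1) < |g ω|} ≤ μ.real {ω | (16 : ℝ) ^ (a + 1) ≤ g ω ^ 4} := by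
    refine measureReal_mono fun ω hω => ?_
    have h3 : ((2 : ℝ) ^ (a + 1)) ^ 4 ≤ |g ω| ^ 4 := by
      gcongr
      exact le_of_lt hω
    rw [← pow_mul, mul_comm, pow_mul, ← abs_pow, abs_of_nonneg (by positivity)] at h3
    norm_num at h3
    exact h3
  have hpos : (0 : ℝ) < 16 ^ a := by positivity
  rw [le_div_iff₀ (by positivity)]
  push_cast
  have h3 : (16 : ℝ) ^ (a + 1) * μ.real {ω | 2 ^ (a + 1) < |g ω|} ≤ 3 :=
    ((mul_le_mul_of_nonneg_left h2 (by positivity)).trans h1).trans h4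
  rw [pow_succ] at h3
  nlinarith

/-- Under a cotype estimate, large values of coefficients with a bounded fourth moment
contribute little. -/
theorem CotypeBound.integral_weightedMean_tail_le {N : ℕ} {K : ℝ} (hK : 0 ≤ K)
    (h : CotypeBound E N K) (μ : Measure Ω) [IsProbabilityMeasure μ]
    (x : Fin n → E) (hx : {k | x k ≠ 0}.ncard ≤ N) {g : Fin n → Ω → ℝ}
    (hg : ∀ k, Measurable (g k)) {B : ℝ} (hB : ∀ k ω, |g k ω| ≤ B)
    (h4 : ∀ k, ∫ ω, g k ω ^ 4 ∂μ ≤ 3) (b a : ℕ) (hab : B ≤ 2 ^ (a + b + 1)) :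
    ∫ ω, weightedMean x (fun k => {ω | 2 ^ (a + 1) < |g k ω|}.indicator (g k) ω) ∂μ ≤
      128 * K / 4 ^ a * rademacherMean x := by
  have hr := rademacherMean_nonneg x
  -- `b` counts the dyadic levels left below the sup bound `B`; `a` rises as `b` falls, so the
  -- constant does not depend on `B`.
  induction b generalizing a with
  | zero =>
    have : ∀ ω k, {ω | 2 ^ (a + 1) < |g k ω|}.indicator (g k) ω = 0 := fun ω k =>
      Set.indicator_of_notMem (by
        simp only [Set.mem_ofPred_eq, not_lt]
        exact (hB k ω).trans hab) _
    have h0 : weightedMean x (fun _ => (0 : ℝ)) = 0 := by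
      rw [weightedMean_eq]; simp
    simp only [this, h0, integral_zero]
    positivity
  | succ b ih =>
    have hms (i k) : MeasurableSet {ω | (2 : ℝ) ^ i < |g k ω|} :=
      measurableSet_lt measurable_const (hg k).abs
    have hbound (s : Fin n → Set Ω) (k ω) : |(s k).indicator (g k) ω| ≤ B := by
      by_cases hω : ω ∈ s k
      · simpa [hω] using hB k ω
      · simpa [hω] using (abs_nonneg _).trans (hB k ω)
    have hint (i : ℕ) := integrable_weightedMean μ x
      (h := fun k => {ω | (2 : ℝ) ^ i < |g k ω|}.indicator (g k))
      (fun k => (hg k).indicator (hms i k)) (hbound _)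
    have hint1 (i : ℕ) := integrable_weightedMean μ x (B := 1)
      (h := fun k => {ω | (2 : ℝ) ^ i < |g k ω|}.indicator (1 : Ω → ℝ))
      (fun k => measurable_one.indicator (hms i k)) (fun k ω => by
        by_cases hω : ω ∈ {ω | (2 : ℝ) ^ i < |g k ω|}
        · rw [Set.indicator_of_mem hω]; simp
        · rw [Set.indicator_of_notMem hω]; simp)
    have hrare := h.integral_weightedMean_indicator_le hK μ x hx
      (fun k => {ω | 2 ^ (a + 1) < |g k ω|}) (hms (a + 1)) (M := 2 * 16 ^ a) (by positivity)
      (fun k => measureReal_lt_abs_le μ (hg k) (hB k) (h4 k) a)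
    have hnext := ih (a + 1) (by convert hab using 2; ring)
    have hpt (ω : Ω) :
        weightedMean x (fun k => {ω | 2 ^ (a + 1) < |g k ω|}.indicator (g k) ω) ≤
          2 * ((2 ^ (a + 2)) ^ 2 *
            weightedMean x (fun k => {ω | 2 ^ (a + 1) < |g k ω|}.indicator 1 ω)) +
          2 * weightedMean x
            (fun k => {ω | 2 ^ (a + 1 + 1) < |g k ω|}.indicator (g k) ω) := by
      have hsplit : (fun k => {ω | 2 ^ (a + 1) < |g k ω|}.indicator (g k) ω) =
          (fun k => if 2 ^ (a + 1) < |g k ω| ∧ |g k ω| ≤ 2 ^ (a + 1 + 1) then g k ω else 0) +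
          fun k => {ω | 2 ^ (a + 1 + 1) < |g k ω|}.indicator (g k) ω := by
        funext k
        have h12 : (2 : ℝ) ^ (a + 1) ≤ 2 ^ (a + 1 + 1) :=
          pow_le_pow_right₀ (by norm_num) (by omega)
        simp only [Set.indicator_apply, Set.mem_ofPred_eq, Pi.add_apply]
        by_cases h1 : (2 : ℝ) ^ (a + 1 + 1) < |g k ω|
        · simp [h1, h12.trans_lt h1, not_le.2 h1]
        · simp [h1, not_lt.1 h1]
      rw [hsplit]
      refine (weightedMean_add_le x _ _).trans ?_
      gcongr
      refine weightedMean_le_sq_mul x fun k => ?_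
      simp only [Set.indicator_apply, Set.mem_ofPred_eq, Pi.one_apply]
      by_cases h1 : (2 : ℝ) ^ (a + 1) < |g k ω|
      · by_cases h2 : |g k ω| ≤ 2 ^ (a + 1 + 1)
        · simp [h1, h2]
        · simp [h1, h2]
      · simp [h1]
    have hI := integral_mono (hint (a + 1))
      ((((hint1 (a + 1)).const_mul _).const_mul 2).add ((hint (a + 1 + 1)).const_mul 2)) hpt
    simp only [Pi.add_apply] at hI
    rw [integral_add (((hint1 (a + 1)).const_mul _).const_mul 2)
      ((hint (a + 1 + 1)).const_mul 2), integral_const_mul, integral_const_mul,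
      integral_const_mul] at hI
    refine hI.trans ?_
    -- The level just above `2^(a+1)` and the remaining tail each contribute `64 * K / 4^a`. The
    -- factor 2 lost in splitting is absorbed because the tail bound falls by 4 per level.
    have e1 : 2 * ((2 ^ (a + 2)) ^ 2 * (4 * K / (2 * 16 ^ a : ℕ) * rademacherMean x)) +
        2 * (128 * K / 4 ^ (a + 1) * rademacherMean x) = 128 * K / 4 ^ a * rademacherMean x := by
      have e2 : ((2 : ℝ) ^ (a + 2)) ^ 2 = 16 * 4 ^ a := by
        rw [← pow_mul, mul_comm, pow_mul]; norm_num [pow_add]; ring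
      have e3 : (16 : ℝ) ^ a = 4 ^ a * 4 ^ a := by rw [← mul_pow]; norm_num
      have e4 : (4 : ℝ) ^ a ≠ 0 := by positivity
      push_cast
      rw [e2, e3, pow_succ]
      field_simp
      ring
    rw [← e1]
    gcongr

/-- The part with `|g k| ≤ 2^(a+1)` is controlled by contraction without `K`; only the tail costs
`K`, with a factor made small by the choice of `a`. -/
theorem CotypeBound.integral_weightedMean_le {N : ℕ} {K : ℝ} (hK : 0 ≤ K)
    (h : CotypeBound E N K) (μ : Measure Ω) [IsProbabilityMeasure μ]
    (x : Fin n → E) (hx : {k | x k ≠ 0}.ncard ≤ N) {g : Fin n → Ω → ℝ}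
    (hg : ∀ k, Measurable (g k)) {B : ℝ} (hB : ∀ k ω, |g k ω| ≤ B)
    (h4 : ∀ k, ∫ ω, g k ω ^ 4 ∂μ ≤ 3) (a : ℕ) :
    ∫ ω, weightedMean x (fun k => g k ω) ∂μ ≤
      (8 * 4 ^ a + 256 * K / 4 ^ a) * rademacherMean x := by
  obtain ⟨b, hb⟩ := pow_unbounded_of_one_lt B (one_lt_two (α := ℝ))
  have htail := h.integral_weightedMean_tail_le hK μ x hx hg hB h4 b a
    (hb.le.trans (pow_le_pow_right₀ (by norm_num) (by omega)))
  have hms (k) : MeasurableSet {ω | (2 : ℝ) ^ (a + 1) < |g k ω|} :=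
    measurableSet_lt measurable_const (hg k).abs
  have hint := integrable_weightedMean μ x
    (h := fun k => {ω | (2 : ℝ) ^ (a + 1) < |g k ω|}.indicator (g k)) (B := B)
    (fun k => (hg k).indicator (hms k)) (fun k ω => by
      by_cases hω : ω ∈ {ω | (2 : ℝ) ^ (a + 1) < |g k ω|}
      · rw [Set.indicator_of_mem hω]; exact hB k ω
      · rw [Set.indicator_of_notMem hω, abs_zero]; exact (abs_nonneg _).trans (hB k ω))
  have hpt (ω : Ω) : weightedMean x (fun k => g k ω) ≤
      2 * ((2 ^ (a + 1)) ^ 2 * rademacherMean x) +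
        2 * weightedMean x (fun k => {ω | 2 ^ (a + 1) < |g k ω|}.indicator (g k) ω) := by
    have hsplit : (fun k => g k ω) =
        (fun k => if |g k ω| ≤ 2 ^ (a + 1) then g k ω else 0) +
        fun k => {ω | 2 ^ (a + 1) < |g k ω|}.indicator (g k) ω := by
      funext k
      simp only [Set.indicator_apply, Set.mem_ofPred_eq, Pi.add_apply]
      by_cases h1 : (2 : ℝ) ^ (a + 1) < |g k ω|
      · simp [h1, not_le.2 h1]
      · simp [h1, not_lt.1 h1]
    rw [hsplit]
    refine (weightedMean_add_le x _ _).trans ?_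
    gcongr
    rw [← weightedMean_one]
    refine weightedMean_le_sq_mul x fun k => ?_
    by_cases h1 : |g k ω| ≤ 2 ^ (a + 1)
    · simp [h1]
    · simp [h1]
  have hI := integral_mono (integrable_weightedMean μ x hg hB)
    ((integrable_const _).add (hint.const_mul 2)) hpt
  simp only [Pi.add_apply] at hI
  rw [integral_add (integrable_const _) (hint.const_mul 2), integral_const,
    probReal_univ, one_smul, integral_const_mul] at hI
  have e2 : ((2 : ℝ) ^ (a + 1)) ^ 2 = 4 * 4 ^ a := by
    rw [← pow_mul, mul_comm, pow_mul]; norm_num [pow_add]; ring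
  rw [e2] at hI
  calc _ ≤ _ := hI
    _ ≤ 2 * (4 * 4 ^ a * rademacherMean x) + 2 * (128 * K / 4 ^ a * rademacherMean x) := by gcongr
    _ = _ := by ring

/-- Randomization: independent symmetric coefficients may be multiplied by random signs. -/
theorem integral_norm_sq_eq_integral_weightedMean (μ : Measure Ω) [IsProbabilityMeasure μ]
    (x : Fin n → E) {g : Fin n → Ω → ℝ} (hg : ∀ k, Measurable (g k)) {B : ℝ}
    (hB : ∀ k ω, |g k ω| ≤ B) (hind : iIndepFun g μ)
    (hsymm : ∀ k, μ.map (fun ω => -g k ω) = μ.map (g k)) :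
    ∫ ω, ‖∑ k, g k ω • x k‖ ^ 2 ∂μ = ∫ ω, weightedMean x (fun k => g k ω) ∂μ := by
  -- By independence the joint law is the product of the marginals, and symmetry keeps each marginal
  -- under a sign change.
  have hlaw (δ : Fin n → ℤˣ) :
      μ.map (fun ω k => ((δ k : ℤ) : ℝ) * g k ω) = μ.map (fun ω k => g k ω) := by
    have hδm (k : Fin n) : Measurable fun ω => ((δ k : ℤ) : ℝ) * g k ω := (hg k).const_mul _
    have hδ : iIndepFun (fun k ω => ((δ k : ℤ) : ℝ) * g k ω) μ :=
      hind.comp (fun k t => ((δ k : ℤ) : ℝ) * t) fun k => measurable_const_mul _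
    rw [(iIndepFun_iff_map_fun_eq_pi_map fun k => (hδm k).aemeasurable).1 hδ,
      (iIndepFun_iff_map_fun_eq_pi_map fun k => (hg k).aemeasurable).1 hind]
    congr 1
    funext k
    rcases Int.units_eq_one_or (δ k) with h | h
    · simp [h]
    · simp [h, hsymm k]
  have hF : Continuous fun a : Fin n → ℝ => ‖∑ k, a k • x k‖ ^ 2 := by fun_prop
  have hsign (δ : Fin n → ℤˣ) :
      ∫ ω, ‖∑ k, (((δ k : ℤ) : ℝ) * g k ω) • x k‖ ^ 2 ∂μ = ∫ ω, ‖∑ k, g k ω • x k‖ ^ 2 ∂μ := by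
    have h1 := integral_map (μ := μ) (φ := fun ω k => ((δ k : ℤ) : ℝ) * g k ω)
      (measurable_pi_lambda _ fun k => (hg k).const_mul _).aemeasurable
      hF.measurable.aestronglyMeasurable
    have h2 := integral_map (μ := μ) (φ := fun ω k => g k ω)
      (measurable_pi_lambda _ hg).aemeasurable hF.measurable.aestronglyMeasurable
    rw [hlaw δ] at h1
    exact h1.symm.trans h2
  have hint (δ : Fin n → ℤˣ) :
      Integrable (fun ω => ‖∑ k, (((δ k : ℤ) : ℝ) * g k ω) • x k‖ ^ 2) μ := by
    refine Integrable.of_bound (C := (∑ k, B * ‖x k‖) ^ 2) (hF.measurable.comp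
      (measurable_pi_lambda _ fun k => (hg k).const_mul ((δ k : ℤ) : ℝ))).aestronglyMeasurable
      (ae_of_all _ fun ω => ?_)
    rw [norm_pow, norm_norm]
    gcongr
    refine (norm_sum_le _ _).trans (Finset.sum_le_sum fun k _ => ?_)
    rw [norm_smul, Real.norm_eq_abs, abs_mul, abs_units, one_mul]
    gcongr
    exact hB k ω
  simp only [weightedMean_eq]
  rw [integral_div, integral_finsetSum _ fun δ _ => hint δ, Finset.sum_congr rfl fun δ _ => hsign δ,
    Finset.sum_const, card_signs, nsmul_eq_mul]
  push_cast
  field_simp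

/-- Integrate `g² ≤ 2|g| + g⁴/4`, which holds by comparing `|g|` with 2: `1 ≤ 2 E|g| + 3/4`. -/
theorem one_div_eight_le_integral_abs (μ : Measure Ω) [IsProbabilityMeasure μ] {g : Ω → ℝ}
    (hg : Measurable g) {B : ℝ} (hB : ∀ ω, |g ω| ≤ B) (h2 : ∫ ω, g ω ^ 2 ∂μ = 1)
    (h4 : ∫ ω, g ω ^ 4 ∂μ ≤ 3) : 1 / 8 ≤ ∫ ω, |g ω| ∂μ := by
  have hint (p : ℕ) : Integrable (fun ω => g ω ^ p) μ := by
    refine Integrable.of_bound (hg.pow_const p).aestronglyMeasurable (B ^ p)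
      (ae_of_all _ fun ω => ?_)
    rw [norm_pow, Real.norm_eq_abs]
    gcongr
    exact hB ω
  have habs : Integrable (fun ω => |g ω|) μ := by simpa using (hint 1).abs
  have hpt (ω : Ω) : g ω ^ 2 ≤ 2 * |g ω| + 1 / 4 * g ω ^ 4 := by
    rw [← sq_abs, show g ω ^ 4 = |g ω| ^ 4 by rw [← abs_pow, abs_of_nonneg (by positivity)]]
    rcases le_total |g ω| 2 with h | h
    · nlinarith [abs_nonneg (g ω), pow_nonneg (abs_nonneg (g ω)) 4]
    · nlinarith [abs_nonneg (g ω), mul_le_mul h h (by norm_num) (abs_nonneg (g ω)),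
        sq_nonneg |g ω|]
  have hI := integral_mono (hint 2) ((habs.const_mul 2).add ((hint 4).const_mul (1 / 4))) hpt
  simp only [Pi.add_apply] at hI
  rw [integral_add (habs.const_mul 2) ((hint 4).const_mul (1 / 4)), integral_const_mul,
    integral_const_mul, h2] at hI
  linarith

/-- After randomization the coefficients may be replaced by their absolute values. Jensen moves the
integral inside, and `E|g k| ≥ 1/8` with contraction gives `64 = 8²`. -/
theorem rademacherMean_le_integral_norm_sq (μ : Measure Ω) [IsProbabilityMeasure μ]
    (x : Fin n → E) {g : Fin n → Ω → ℝ} (hg : ∀ k, Measurable (g k)) {B : ℝ}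
    (hB : ∀ k ω, |g k ω| ≤ B) (hind : iIndepFun g μ)
    (hsymm : ∀ k, μ.map (fun ω => -g k ω) = μ.map (g k)) (h2 : ∀ k, ∫ ω, g k ω ^ 2 ∂μ = 1)
    (h4 : ∀ k, ∫ ω, g k ω ^ 4 ∂μ ≤ 3) :
    rademacherMean x ≤ 64 * ∫ ω, ‖∑ k, g k ω • x k‖ ^ 2 ∂μ := by
  rw [integral_norm_sq_eq_integral_weightedMean μ x hg hB hind hsymm]
  have h1 := weightedMean_integral_le μ x (h := fun k ω => |g k ω|) (fun k => (hg k).abs)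
    (B := B) (fun k ω => by rw [abs_abs]; exact hB k ω)
  simp only [weightedMean_abs] at h1
  have h3 : weightedMean x 1 ≤ 8 ^ 2 * weightedMean x (fun k => ∫ ω, |g k ω| ∂μ) := by
    refine weightedMean_le_sq_mul x fun k => ?_
    have := one_div_eight_le_integral_abs μ (hg k) (hB k) (h2 k) (h4 k)
    rw [abs_of_nonneg (a := 8 * _) (by linarith), Pi.one_apply, abs_one]
    linarith
  rw [weightedMean_one] at h3
  linarith

end RandomCoefficients

/-! ### Moments of the entries of a Haar orthogonal matrix -/

section OrthogonalMoments

variable {n : ℕ}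

/-- The reflection with matrix `[[c, t], [t, -c]]` in the plane of the coordinates `i`, `k`. -/
def planeReflection (i k : Fin n) (c t : ℝ) : Matrix (Fin n) (Fin n) ℝ :=
  Matrix.of fun a b =>
    if a = i then c * (1 : Matrix (Fin n) (Fin n) ℝ) i b + t * (1 : Matrix (Fin n) (Fin n) ℝ) k b
    else if a = k then
      t * (1 : Matrix (Fin n) (Fin n) ℝ) i b - c * (1 : Matrix (Fin n) (Fin n) ℝ) k b
    else (1 : Matrix (Fin n) (Fin n) ℝ) a b

theorem planeReflection_mul_apply (i k : Fin n) (c t : ℝ) (X : Matrix (Fin n) (Fin n) ℝ)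
    (a b : Fin n) :
    (planeReflection i k c t * X) a b =
      if a = i then c * X i b + t * X k b else if a = k then t * X i b - c * X k b else X a b := by
  rw [Matrix.mul_apply]
  unfold planeReflection
  simp only [Matrix.of_apply]
  split_ifs <;>
    simp [Matrix.one_apply, add_mul, sub_mul, Finset.sum_add_distrib, Finset.sum_sub_distrib]

/-- The matrix is symmetric and its square is the identity. -/
theorem planeReflection_mem {i k : Fin n} (hik : i ≠ k) {c t : ℝ} (h : c ^ 2 + t ^ 2 = 1) :
    planeReflection i k c t ∈ Matrix.orthogonalGroup (Fin n) ℝ := by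
  have hsymm : (planeReflection i k c t)ᵀ = planeReflection i k c t := by
    ext a b
    simp only [Matrix.transpose_apply, planeReflection, Matrix.of_apply, Matrix.one_apply]
    grind
  rw [Matrix.mem_orthogonalGroup_iff, hsymm]
  ext a b
  rw [planeReflection_mul_apply]
  simp only [planeReflection, Matrix.of_apply]
  by_cases h1 : a = i
  · subst h1
    simp only [if_true, hik.symm, if_false]
    linear_combination ((1 : Matrix (Fin n) (Fin n) ℝ) a b) * h
  · by_cases h2 : a = k
    · subst h2
      simp only [if_true, h1, if_false]
      linear_combination ((1 : Matrix (Fin n) (Fin n) ℝ) a b) * h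
    · simp [h1, h2]

theorem sum_sq_orthogonal (u : Matrix.orthogonalGroup (Fin n) ℝ) (j : Fin n) :
    ∑ i, (u : Matrix (Fin n) (Fin n) ℝ) i j ^ 2 = 1 := by
  have h := (Matrix.mem_orthogonalGroup_iff' (Fin n) ℝ).1 u.2
  have h2 := congrFun (congrFun h j) j
  rw [Matrix.mul_apply, Matrix.one_apply_eq] at h2
  rw [← h2]
  refine Finset.sum_congr rfl fun i _ => ?_
  simp [sq]

theorem abs_orthogonal_le_one (u : Matrix.orthogonalGroup (Fin n) ℝ) (i j : Fin n) :
    |(u : Matrix (Fin n) (Fin n) ℝ) i j| ≤ 1 := by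
  rw [← sq_le_one_iff_abs_le_one, ← sum_sq_orthogonal u j]
  exact Finset.single_le_sum (f := fun i => (u : Matrix (Fin n) (Fin n) ℝ) i j ^ 2)
    (fun _ _ => sq_nonneg _) (Finset.mem_univ i)

theorem continuous_orthogonal_apply (i j : Fin n) :
    Continuous fun u : Matrix.orthogonalGroup (Fin n) ℝ => (u : Matrix (Fin n) (Fin n) ℝ) i j :=
  continuous_subtype_val.matrix_elem i j

variable (ν : Measure (Matrix.orthogonalGroup (Fin n) ℝ))

theorem integrable_orthogonal_mul_pow [IsProbabilityMeasure ν] (i k j : Fin n) (p q : ℕ) :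
    Integrable (fun u : Matrix.orthogonalGroup (Fin n) ℝ =>
      (u : Matrix (Fin n) (Fin n) ℝ) i j ^ p * (u : Matrix (Fin n) (Fin n) ℝ) k j ^ q) ν := by
  refine Integrable.of_bound (C := 1) ?_ (ae_of_all _ fun u => ?_)
  · exact (((continuous_orthogonal_apply i j).pow p).mul
      ((continuous_orthogonal_apply k j).pow q)).measurable.aestronglyMeasurable
  · rw [norm_mul, norm_pow, norm_pow]
    exact mul_le_one₀ (pow_le_one₀ (norm_nonneg _) (abs_orthogonal_le_one u i j))
      (by positivity) (pow_le_one₀ (norm_nonneg _) (abs_orthogonal_le_one u k j))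

theorem integrable_orthogonal_pow [IsProbabilityMeasure ν] (i j : Fin n) (p : ℕ) :
    Integrable (fun u : Matrix.orthogonalGroup (Fin n) ℝ =>
      (u : Matrix (Fin n) (Fin n) ℝ) i j ^ p) ν := by
  simpa using integrable_orthogonal_mul_pow ν i i j p 0

variable [ν.IsMulLeftInvariant]

/-- The reflection with `c = 0`, `t = 1` exchanges the two rows. -/
theorem integral_orthogonal_pow_eq (i k j : Fin n) (p : ℕ) :
    ∫ u, (u : Matrix (Fin n) (Fin n) ℝ) i j ^ p ∂ν =
      ∫ u, (u : Matrix (Fin n) (Fin n) ℝ) k j ^ p ∂ν := by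
  by_cases hik : i = k
  · rw [hik]
  have h := integral_mul_left_eq_self (μ := ν)
    (fun u => (u : Matrix (Fin n) (Fin n) ℝ) i j ^ p)
    ⟨planeReflection i k 0 1, planeReflection_mem hik (by norm_num)⟩
  rw [← h]
  simp [planeReflection_mul_apply]

theorem integral_orthogonal_sq [IsProbabilityMeasure ν] (i j : Fin n) :
    n * ∫ u, (u : Matrix (Fin n) (Fin n) ℝ) i j ^ 2 ∂ν = 1 := by
  have h : ∫ u, ∑ k, (u : Matrix (Fin n) (Fin n) ℝ) k j ^ 2 ∂ν = 1 := by
    simp [sum_sq_orthogonal]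
  rw [integral_finsetSum _ fun k _ => integrable_orthogonal_pow ν k j 2,
    Finset.sum_congr rfl fun k _ => integral_orthogonal_pow_eq ν k i j 2] at h
  simpa using h

/-- Invariance under `(p, q) ↦ ((p+q)/√2, (p-q)/√2)`: the sum of fourth powers becomes `(p⁴+q⁴)/2 +
3p²q²`, and both entries have the same fourth moment. -/
theorem integral_orthogonal_sq_mul_sq [IsProbabilityMeasure ν] {i k : Fin n} (hik : i ≠ k) (j : Fin n) :
    ∫ u, (u : Matrix (Fin n) (Fin n) ℝ) i j ^ 2 * (u : Matrix (Fin n) (Fin n) ℝ) k j ^ 2 ∂ν =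
      (∫ u, (u : Matrix (Fin n) (Fin n) ℝ) i j ^ 4 ∂ν) / 3 := by
  have hc : (√(1 / 2) : ℝ) ^ 2 = 1 / 2 := Real.sq_sqrt (by norm_num)
  have h := integral_mul_left_eq_self (μ := ν)
    (fun u => (u : Matrix (Fin n) (Fin n) ℝ) i j ^ 4 + (u : Matrix (Fin n) (Fin n) ℝ) k j ^ 4)
    ⟨planeReflection i k √(1 / 2) √(1 / 2), planeReflection_mem hik (by rw [hc]; norm_num)⟩
  have hpt (u : Matrix.orthogonalGroup (Fin n) ℝ) :
      (planeReflection i k √(1 / 2) √(1 / 2) * (u : Matrix (Fin n) (Fin n) ℝ)) i j ^ 4 +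
        (planeReflection i k √(1 / 2) √(1 / 2) * (u : Matrix (Fin n) (Fin n) ℝ)) k j ^ 4 =
      1 / 2 * ((u : Matrix (Fin n) (Fin n) ℝ) i j ^ 4 + (u : Matrix (Fin n) (Fin n) ℝ) k j ^ 4) +
        3 * ((u : Matrix (Fin n) (Fin n) ℝ) i j ^ 2 *
          (u : Matrix (Fin n) (Fin n) ℝ) k j ^ 2) := by
    rw [planeReflection_mul_apply, planeReflection_mul_apply]
    simp only [if_true, hik.symm, if_false]
    generalize (u : Matrix (Fin n) (Fin n) ℝ) i j = p
    generalize (u : Matrix (Fin n) (Fin n) ℝ) k j = q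
    have e1 : √(1 / 2) * p + √(1 / 2) * q = √(1 / 2) * (p + q) := by ring
    have e2 : √(1 / 2) * p - √(1 / 2) * q = √(1 / 2) * (p - q) := by ring
    have e3 : (√(1 / 2) : ℝ) ^ 4 = 1 / 4 := by
      rw [show 4 = 2 * 2 from rfl, pow_mul, hc]; norm_num
    rw [e1, e2, mul_pow, mul_pow, e3]
    ring
  have i4 := fun k => integrable_orthogonal_pow ν k j 4
  have i22 := integrable_orthogonal_mul_pow ν i k j 2 2
  have i44 : Integrable (fun u : Matrix.orthogonalGroup (Fin n) ℝ =>
    (u : Matrix (Fin n) (Fin n) ℝ) i j ^ 4 + (u : Matrix (Fin n) (Fin n) ℝ) k j ^ 4) ν :=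
    (i4 i).add (i4 k)
  simp only [Submonoid.coe_mul, hpt] at h
  rw [integral_add (i44.const_mul _) (i22.const_mul _), integral_const_mul,
    integral_const_mul, integral_add (i4 i) (i4 k), integral_orthogonal_pow_eq ν k i j 4] at h
  linarith

/-- Square the identity that a column has norm one and integrate. Each of the `n²` mixed moments is
at least a third of the fourth moment, the diagonal ones trivially. -/
theorem integral_orthogonal_pow_four_le [IsProbabilityMeasure ν] (i j : Fin n) :
    n ^ 2 * ∫ u, (u : Matrix (Fin n) (Fin n) ℝ) i j ^ 4 ∂ν ≤ 3 := by
  set m := ∫ u, (u : Matrix (Fin n) (Fin n) ℝ) i j ^ 4 ∂ν with hm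
  have hm0 : 0 ≤ m := integral_nonneg fun u => by positivity
  have h : ∫ u, (∑ a, (u : Matrix (Fin n) (Fin n) ℝ) a j ^ 2) *
      (∑ b, (u : Matrix (Fin n) (Fin n) ℝ) b j ^ 2) ∂ν = 1 := by
    simp [sum_sq_orthogonal]
  simp only [Finset.sum_mul_sum] at h
  rw [integral_finsetSum _ fun a _ => integrable_finsetSum _ fun b _ =>
    integrable_orthogonal_mul_pow ν a b j 2 2] at h
  simp only [integral_finsetSum _ fun b _ => integrable_orthogonal_mul_pow ν _ b j 2 2] at h
  have hab (a b : Fin n) : m / 3 ≤ ∫ u, (u : Matrix (Fin n) (Fin n) ℝ) a j ^ 2 *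
      (u : Matrix (Fin n) (Fin n) ℝ) b j ^ 2 ∂ν := by
    by_cases hne : a = b
    · subst hne
      have : ∫ u, (u : Matrix (Fin n) (Fin n) ℝ) a j ^ 2 *
          (u : Matrix (Fin n) (Fin n) ℝ) a j ^ 2 ∂ν = m := by
        rw [hm, integral_orthogonal_pow_eq ν i a j 4]
        congr 1; ext u; ring
      rw [this]; linarith
    · rw [integral_orthogonal_sq_mul_sq ν hne, hm, integral_orthogonal_pow_eq ν i a j 4]
  have hle : ∑ _a : Fin n, ∑ _b : Fin n, m / 3 ≤ 1 := by
    rw [← h]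
    exact Finset.sum_le_sum fun a _ => Finset.sum_le_sum fun b _ => hab a b
  simp only [Finset.sum_const, Finset.card_univ, Fintype.card_fin, nsmul_eq_mul] at hle
  nlinarith

theorem map_neg_orthogonal_apply (i j : Fin n) :
    ν.map (fun u : Matrix.orthogonalGroup (Fin n) ℝ => -(u : Matrix (Fin n) (Fin n) ℝ) i j) =
      ν.map (fun u : Matrix.orthogonalGroup (Fin n) ℝ => (u : Matrix (Fin n) (Fin n) ℝ) i j) := by
  have hm := (continuous_orthogonal_apply i j).measurable
  have h := map_mul_left_eq_self ν (-1)
  conv_rhs => rw [← h]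
  rw [Measure.map_map hm (measurable_const_mul _)]
  congr 1
  ext u
  simp only [Function.comp_apply, neg_mul, one_mul]
  rfl

end OrthogonalMoments

/-! ### The normalized corner entries as random coefficients -/

section QuantizedRademacher

variable {Ω : Type*} [MeasurableSpace Ω] {μ : Measure Ω} {S : Type*}
  {d : S → ℕ}

/-- The normalized corner entry of a random orthogonal matrix. -/
noncomputable def corner (hd : ∀ s, 0 < d s) (ρ : (s : S) → Ω → Matrix.orthogonalGroup (Fin (d s)) ℝ) (s : S)
    (ω : Ω) : ℝ :=
  √(d s) * (ρ s ω : Matrix (Fin (d s)) (Fin (d s)) ℝ) ⟨0, hd s⟩ ⟨0, hd s⟩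

theorem abs_corner_le {Ω S : Type*} {d : S → ℕ} (hd : ∀ s, 0 < d s)
    {ρ : (s : S) → Ω → Matrix.orthogonalGroup (Fin (d s)) ℝ} (s : S) (ω : Ω) : |corner hd ρ s ω| ≤ √(d s) := by
  rw [corner, abs_mul, abs_of_nonneg (Real.sqrt_nonneg _)]
  exact mul_le_of_le_one_right (Real.sqrt_nonneg _) (abs_orthogonal_le_one _ _ _)

variable (hd : ∀ s, 0 < d s) {ρ : (s : S) → Ω → Matrix.orthogonalGroup (Fin (d s)) ℝ}

theorem measurable_corner (hρ : IsQuantizedRademacher μ ρ) (s : S) : Measurable (corner hd ρ s) :=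
  ((continuous_orthogonal_apply _ _).measurable.comp (hρ.measurable s)).const_mul _

theorem iIndepFun_corner (hρ : IsQuantizedRademacher μ ρ) : iIndepFun (corner hd ρ) μ :=
  hρ.indep.comp (fun s u => √(d s) * (u : Matrix (Fin (d s)) (Fin (d s)) ℝ) ⟨0, hd s⟩ ⟨0, hd s⟩)
    fun _ => (continuous_orthogonal_apply _ _).measurable.const_mul _

theorem integral_corner_pow (hρ : IsQuantizedRademacher μ ρ) (s : S) (p : ℕ) :
    ∫ ω, corner hd ρ s ω ^ p ∂μ = √(d s) ^ p *
      ∫ u, (u : Matrix (Fin (d s)) (Fin (d s)) ℝ) ⟨0, hd s⟩ ⟨0, hd s⟩ ^ p ∂(μ.map (ρ s)) := by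
  rw [integral_map (hρ.measurable s).aemeasurable
    ((continuous_orthogonal_apply _ _).measurable.pow_const p).aestronglyMeasurable,
    ← integral_const_mul]
  simp only [corner, mul_pow]

theorem integral_corner_sq [IsProbabilityMeasure μ] (hρ : IsQuantizedRademacher μ ρ) (s : S) : ∫ ω, corner hd ρ s ω ^ 2 ∂μ = 1 := by
  have := hρ.haar s
  have := Measure.isProbabilityMeasure_map (μ := μ) (hρ.measurable s).aemeasurable
  rw [integral_corner_pow hd hρ, Real.sq_sqrt (Nat.cast_nonneg _)]
  exact integral_orthogonal_sq _ _ _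

theorem integral_corner_pow_four_le [IsProbabilityMeasure μ] (hρ : IsQuantizedRademacher μ ρ) (s : S) : ∫ ω, corner hd ρ s ω ^ 4 ∂μ ≤ 3 := by
  have := hρ.haar s
  have := Measure.isProbabilityMeasure_map (μ := μ) (hρ.measurable s).aemeasurable
  rw [integral_corner_pow hd hρ, show 4 = 2 * 2 from rfl, pow_mul √_,
    Real.sq_sqrt (Nat.cast_nonneg _)]
  exact integral_orthogonal_pow_four_le _ _ _

theorem map_neg_corner [IsProbabilityMeasure μ] (hρ : IsQuantizedRademacher μ ρ) (s : S) : μ.map (fun ω => -corner hd ρ s ω) = μ.map (corner hd ρ s) := by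
  have := hρ.haar s
  have := Measure.isProbabilityMeasure_map (μ := μ) (hρ.measurable s).aemeasurable
  have hc := (continuous_orthogonal_apply (⟨0, hd s⟩ : Fin (d s)) ⟨0, hd s⟩).measurable
  have hn : Measurable fun u : Matrix.orthogonalGroup (Fin (d s)) ℝ =>
      -(u : Matrix (Fin (d s)) (Fin (d s)) ℝ) ⟨0, hd s⟩ ⟨0, hd s⟩ := hc.neg
  have h := congrArg (Measure.map fun r : ℝ => √(d s) * r)
    (map_neg_orthogonal_apply (μ.map (ρ s)) ⟨0, hd s⟩ ⟨0, hd s⟩)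
  rw [Measure.map_map (measurable_const_mul _) hn, Measure.map_map (measurable_const_mul _) hc,
    Measure.map_map ((measurable_const_mul _).comp hn) (hρ.measurable s),
    Measure.map_map ((measurable_const_mul _).comp hc) (hρ.measurable s)] at h
  convert h using 2
  · funext ω
    simp [corner]
  · rfl

theorem integral_corner [IsProbabilityMeasure μ] (hρ : IsQuantizedRademacher μ ρ) (s : S) : ∫ ω, corner hd ρ s ω ∂μ = 0 := by
  have hm := measurable_corner hd hρ s
  have h1 := integral_map (μ := μ) hm.neg.aemeasurable
    (f := fun r : ℝ => r) measurable_id.aestronglyMeasurable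
  have h2 := integral_map (μ := μ) hm.aemeasurable
    (f := fun r : ℝ => r) measurable_id.aestronglyMeasurable
  have h3 : μ.map (-corner hd ρ s) = μ.map (corner hd ρ s) := map_neg_corner hd hρ s
  rw [h3, h2] at h1
  simp only [Pi.neg_apply, integral_neg] at h1
  linarith

theorem integral_corner_mul_corner [IsProbabilityMeasure μ] [DecidableEq S] (hρ : IsQuantizedRademacher μ ρ) (s t : S) :
    ∫ ω, corner hd ρ s ω * corner hd ρ t ω ∂μ = if s = t then 1 else 0 := by
  split_ifs with h
  · subst h
    rw [← integral_corner_sq hd hρ s]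
    congr 1; ext ω; ring
  · rw [((iIndepFun_corner hd hρ).indepFun h).integral_fun_mul_eq_mul_integral
      (measurable_corner hd hρ s).aestronglyMeasurable
      (measurable_corner hd hρ t).aestronglyMeasurable, integral_corner hd hρ s, zero_mul]

end QuantizedRademacher

/-! ### Operator norm and Schatten norm of scalar matrices -/

section ScalarMatrices

theorem opNorm_le_frobenius {m n : ℕ} (a : Matrix (Fin m) (Fin n) ℂ) :
    opNorm a ≤ √(∑ i, ∑ k, ‖a i k‖ ^ 2) := by
  refine ContinuousLinearMap.opNorm_le_bound _ (Real.sqrt_nonneg _) fun v => ?_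
  rw [EuclideanSpace.norm_eq, EuclideanSpace.norm_eq, ← Real.sqrt_mul (by positivity),
    Finset.sum_mul]
  refine Real.sqrt_le_sqrt (Finset.sum_le_sum fun i _ => ?_)
  have h : ‖(Matrix.toEuclideanLin a v) i‖ ≤ ∑ k, ‖a i k‖ * ‖v k‖ := by
    rw [Matrix.toLpLin_apply]
    simp only [Matrix.mulVec, dotProduct]
    exact (norm_sum_le _ _).trans_eq (Finset.sum_congr rfl fun k _ => norm_mul _ _)
  calc _ ≤ (∑ k, ‖a i k‖ * ‖v k‖) ^ 2 := by gcongr; exact h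
    _ ≤ _ := Finset.sum_mul_sq_le_sq_mul_sq _ _ _

theorem opNorm_nonneg {m n : ℕ} (a : Matrix (Fin m) (Fin n) ℂ) : 0 ≤ opNorm a := norm_nonneg _

theorem trace_mul_self_re {n : ℕ} {H : Matrix (Fin n) (Fin n) ℂ} (hH : Hᴴ = H) :
    (H * H).trace.re = ∑ i, ∑ j, ‖H i j‖ ^ 2 := by
  simp only [Matrix.trace, Matrix.diag_apply, Matrix.mul_apply, Complex.re_sum]
  refine Finset.sum_congr rfl fun i _ => Finset.sum_congr rfl fun j _ => ?_
  have h : H j i = star (H i j) := by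
    rw [← Matrix.conjTranspose_apply, hH]
  rw [h, Complex.star_def, Complex.mul_conj, Complex.normSq_eq_norm_sq, Complex.ofReal_re]

theorem diag_sq_le_trace {n : ℕ} {H : Matrix (Fin n) (Fin n) ℂ} (hH : Hᴴ = H) (i : Fin n) :
    ‖H i i‖ ^ 2 ≤ (H * H).trace.re := by
  rw [trace_mul_self_re hH]
  exact (Finset.single_le_sum (f := fun j => ‖H i j‖ ^ 2) (fun _ _ => by positivity)
    (Finset.mem_univ i)).trans (Finset.single_le_sum (f := fun i => ∑ j, ‖H i j‖ ^ 2)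
    (fun _ _ => by positivity) (Finset.mem_univ i))

theorem sqrt_le_rpow_of_sq_le {X Y : ℝ} (hY : 0 ≤ Y) (h : Y ^ 2 ≤ X) :
    √Y ≤ X ^ (1 / 4 : ℝ) := by
  calc √Y = (Y ^ 2) ^ (1 / 4 : ℝ) := by
        rw [Real.sqrt_eq_rpow, ← Real.rpow_natCast, ← Real.rpow_mul hY]; norm_num
    _ ≤ _ := Real.rpow_le_rpow (by positivity) h (by norm_num)

/-- The squared norm of a column is a diagonal entry of `bᴴ * b`, whose square is at most the trace
of `(bᴴ * b)²`. -/
theorem sqrt_col_le_schattenFour {n : ℕ} (b : Matrix (Fin n) (Fin n) ℂ) (j : Fin n) :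
    √(∑ k, ‖b k j‖ ^ 2) ≤ schattenFour b := by
  refine sqrt_le_rpow_of_sq_le (by positivity) ?_
  refine le_trans (le_of_eq ?_) (diag_sq_le_trace (H := bᴴ * b) (by simp) j)
  congr 1
  rw [Matrix.mul_apply]
  have (k : Fin n) : bᴴ j k * b k j = ((‖b k j‖ ^ 2 : ℝ) : ℂ) := by
    rw [Matrix.conjTranspose_apply, Complex.star_def, mul_comm, Complex.mul_conj,
      Complex.normSq_eq_norm_sq]
  simp only [this]
  rw [← Complex.ofReal_sum, Complex.norm_of_nonneg (by positivity)]

theorem sqrt_row_le_schattenFour {n : ℕ} (a : Matrix (Fin n) (Fin n) ℂ) (i : Fin n) :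
    √(∑ k, ‖a i k‖ ^ 2) ≤ schattenFour a := by
  have htr : schattenFour aᴴ = schattenFour a := by
    unfold schattenFour
    rw [Matrix.conjTranspose_conjTranspose, mul_assoc a, Matrix.trace_mul_comm a, mul_assoc,
      mul_assoc, mul_assoc]
  rw [← htr]
  convert sqrt_col_le_schattenFour aᴴ i using 4 with k
  simp

theorem schattenFour_nonneg {n : ℕ} (a : Matrix (Fin n) (Fin n) ℂ) : 0 ≤ schattenFour a := by
  refine Real.rpow_nonneg ?_ _
  rw [trace_mul_self_re (by simp)]
  positivity

theorem norm_apply_le_schattenFour {n : ℕ} (a : Matrix (Fin n) (Fin n) ℂ) (i j : Fin n) :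
    ‖a i j‖ ≤ schattenFour a := by
  refine le_trans (Real.le_sqrt_of_sq_le ?_) (sqrt_row_le_schattenFour a i)
  exact Finset.single_le_sum (f := fun k => ‖a i k‖ ^ 2) (fun _ _ => by positivity)
    (Finset.mem_univ j)

theorem schattenFour_single {n : ℕ} (i : Fin n) :
    schattenFour (Matrix.single i i (1 : ℂ)) = 1 := by
  simp [schattenFour, Matrix.conjTranspose_single]

theorem schattenFour_one : schattenFour (1 : Matrix (Fin 1) (Fin 1) ℂ) = 1 := by
  simp [schattenFour]

end ScalarMatrices

/-! ### Vector-valued norms at matrix level one -/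

section VectorValued

theorem biMul_one {V : Type*} [AddCommGroup V] [Module ℂ V] {n : ℕ} (x : Matrix (Fin n) (Fin n) V) :
    biMul 1 x 1 = x := by
  ext i j
  simp [biMul, Matrix.one_apply, Finset.sum_ite_eq]

theorem biMul_fin_one {V : Type*} [AddCommGroup V] [Module ℂ V]
    (a b : Matrix (Fin 1) (Fin 1) ℂ) (v : V) :
    biMul a (Matrix.of fun _ _ => v) b = Matrix.of fun _ _ => (a 0 0 * b 0 0) • v := by
  ext i j
  rw [Subsingleton.elim i 0, Subsingleton.elim j 0]
  simp [biMul]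

theorem le_matNormOf {V : Type*} [AddCommGroup V] [Module ℂ V]
    (s : (n : ℕ) → Matrix (Fin n) (Fin n) V → ℝ≥0∞) (x : Matrix (Fin 1) (Fin 1) V) :
    s 1 x ≤ matNormOf s 1 x := by
  unfold matNormOf
  refine le_iSup_of_le 1 (le_iSup_of_le 1 (le_iSup_of_le schattenFour_one.le
    (le_iSup_of_le schattenFour_one.le ?_)))
  rw [biMul_one]

theorem matNormOf_le {V : Type*} [AddCommGroup V] [Module ℂ V]
    (s : (n : ℕ) → Matrix (Fin n) (Fin n) V → ℝ≥0∞) (v : V) {B : ℝ≥0∞}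
    (h : ∀ c : ℂ, ‖c‖ ≤ 1 → s 1 (Matrix.of fun _ _ => c • v) ≤ B) :
    matNormOf s 1 (Matrix.of fun _ _ => v) ≤ B := by
  unfold matNormOf
  refine iSup_le fun a => iSup_le fun b => iSup_le fun ha => iSup_le fun hb => ?_
  rw [biMul_fin_one]
  refine h _ ?_
  rw [norm_mul]
  exact mul_le_one₀ ((norm_apply_le_schattenFour a 0 0).trans ha) (norm_nonneg _)
    ((norm_apply_le_schattenFour b 0 0).trans hb)

theorem exists_bound_of_cbNorm_lt {V W : Type*} [AddCommGroup V] [Module ℂ V] [AddCommGroup W]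
    [Module ℂ W] {NV : (n : ℕ) → Matrix (Fin n) (Fin n) V → ℝ≥0∞}
    {NW : (n : ℕ) → Matrix (Fin n) (Fin n) W → ℝ≥0∞} {D : Submodule ℂ V} {u : V → W} {C : ℝ≥0∞}
    (h : cbNorm NV NW D u < C) {v : V} (hv : v ∈ D) :
    NW 1 (Matrix.of fun _ _ => u v) ≤ C * NV 1 (Matrix.of fun _ _ => v) := by
  simp only [cbNorm, iInf_lt_iff] at h
  obtain ⟨K, hK, hlt⟩ := h
  refine (hK 1 (Matrix.of fun _ _ => v) fun _ _ => hv).trans ?_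
  gcongr

variable {E : Type*} [NormedAddCommGroup E] [NormedSpace ℂ E] [OperatorSpace E]

theorem OperatorSpace.matNorm_nonneg (n : ℕ) (x : Matrix (Fin n) (Fin n) E) :
    0 ≤ OperatorSpace.matNorm n x := by
  have h1 := OperatorSpace.matNorm_add_le n x ((-1 : ℂ) • x)
  have h2 := OperatorSpace.matNorm_smul n (0 : ℂ) x
  rw [OperatorSpace.matNorm_smul] at h1
  have h3 : x + (-1 : ℂ) • x = (0 : ℂ) • x := by rw [neg_one_smul, zero_smul, add_neg_cancel]
  rw [h3, h2] at h1
  simp at h1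
  exact h1

/-- The entry is (row of `a`) · `y` · (column of `b`), so Ruan's inequality for rectangular
compressions to `M_1` applies. -/
theorem norm_biMul_le {n : ℕ} (a y b) (i j : Fin n) :
    ‖biMul a y b i j‖ ≤ schattenFour a * OperatorSpace.matNorm (E := E) n y * schattenFour b := by
  let r : Matrix (Fin 1) (Fin n) ℂ := Matrix.of fun _ k => a i k
  let c : Matrix (Fin n) (Fin 1) ℂ := Matrix.of fun k _ => b k j
  have hr : opNorm r ≤ schattenFour a := by
    refine (opNorm_le_frobenius r).trans ?_
    simpa [r] using sqrt_row_le_schattenFour a i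
  have hc : opNorm c ≤ schattenFour b := by
    refine (opNorm_le_frobenius c).trans ?_
    simpa [c] using sqrt_col_le_schattenFour b j
  have h := OperatorSpace.matNorm_biMul_le n 1 r y c
  have heq : biMul r y c = Matrix.of fun _ _ => biMul a y b i j := by
    ext k l
    simp [biMul, r, c]
  rw [heq, OperatorSpace.matNorm_one] at h
  refine h.trans ?_
  have := OperatorSpace.matNorm_nonneg n y
  have := opNorm_nonneg c
  have := schattenFour_nonneg a
  gcongr

theorem ofReal_norm_apply_le_schattenTwo {n : ℕ} (x : Matrix (Fin n) (Fin n) E) (i j : Fin n) :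
    ENNReal.ofReal ‖x i j‖ ≤ schattenTwo n x := by
  unfold schattenTwo
  refine le_iInf fun a => le_iInf fun y => le_iInf fun b => le_iInf fun h => ?_
  rw [← h]
  exact ENNReal.ofReal_le_ofReal (norm_biMul_le a y b i j)

theorem matNorm_single_le {n : ℕ} (i : Fin n) (e : E) :
    OperatorSpace.matNorm n (Matrix.single i i e) ≤ ‖e‖ := by
  let c : Matrix (Fin n) (Fin 1) ℂ := Matrix.of fun k _ => if i = k then 1 else 0
  let r : Matrix (Fin 1) (Fin n) ℂ := Matrix.of fun _ k => if i = k then 1 else 0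
  have hr : opNorm r ≤ 1 := by
    refine (opNorm_le_frobenius r).trans (le_of_eq ?_)
    simp [r, apply_ite]
  have hc : opNorm c ≤ 1 := by
    refine (opNorm_le_frobenius c).trans (le_of_eq ?_)
    simp [c, apply_ite]
  have h := OperatorSpace.matNorm_biMul_le 1 n c (Matrix.of fun _ _ => e) r
  have heq : biMul c (Matrix.of fun _ _ => e) r = Matrix.single i i e := by
    ext k l
    by_cases hk : i = k <;> by_cases hl : i = l <;>
      simp [biMul, r, c, Matrix.single_apply, hk, hl]
  rw [heq, OperatorSpace.matNorm_one] at h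
  refine h.trans ?_
  have := opNorm_nonneg r
  have := opNorm_nonneg c
  calc opNorm c * ‖e‖ * opNorm r ≤ 1 * ‖e‖ * 1 := by gcongr
    _ = ‖e‖ := by ring

/-- Factor through the rank-one projection onto coordinate `i`, which has Schatten norm one. -/
theorem schattenTwo_single_le {n : ℕ} (i : Fin n) (e : E) :
    schattenTwo n (Matrix.single i i e) ≤ ENNReal.ofReal ‖e‖ := by
  unfold schattenTwo
  refine iInf_le_of_le (Matrix.single i i 1) (iInf_le_of_le (Matrix.single i i e)
    (iInf_le_of_le (Matrix.single i i 1) (iInf_le_of_le ?_ ?_)))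
  · ext k l
    simp only [biMul]
    rw [Finset.sum_eq_single i, Finset.sum_eq_single i]
    · by_cases hk : i = k <;> by_cases hl : i = l <;>
        simp [Matrix.single_apply, hk, hl]
    · intro b _ hb
      simp [Matrix.single_apply, hb.symm]
    · simp
    · intro b _ hb
      refine Finset.sum_eq_zero fun l _ => ?_
      simp [Matrix.single_apply, hb.symm]
    · simp
  · rw [schattenFour_single, one_mul, mul_one]
    exact ENNReal.ofReal_le_ofReal (matNorm_single_le i e)

theorem schattenTwo_one (e : E) :
    schattenTwo 1 (Matrix.of fun _ _ => e) = ENNReal.ofReal ‖e‖ := by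
  refine le_antisymm ?_ (ofReal_norm_apply_le_schattenTwo (Matrix.of fun _ _ => e) 0 0)
  have : (Matrix.of fun _ _ => e : Matrix (Fin 1) (Fin 1) E) = Matrix.single 0 0 e := by
    ext i j
    rw [Subsingleton.elim i 0, Subsingleton.elim j 0]
    simp
  rw [this]
  exact schattenTwo_single_le 0 e

theorem funSchatten_one {Ω : Type*} [MeasurableSpace Ω] (μ : Measure Ω) (f : Ω → E) :
    funSchatten μ 1 (Matrix.of fun _ _ => f) =
      (∫⁻ ω, ENNReal.ofReal ‖f ω‖ ^ 2 ∂μ) ^ (1 / 2 : ℝ) := by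
  unfold funSchatten
  congr 2
  funext ω
  congr 1
  exact schattenTwo_one (f ω)

theorem funMatNorm_one {Ω : Type*} [MeasurableSpace Ω] (μ : Measure Ω) (f : Ω → E) :
    funMatNorm μ 1 (Matrix.of fun _ _ => f) =
      (∫⁻ ω, ENNReal.ofReal ‖f ω‖ ^ 2 ∂μ) ^ (1 / 2 : ℝ) := by
  refine le_antisymm (matNormOf_le _ _ fun c hc => ?_) ?_
  · rw [funSchatten_one]
    gcongr with ω
    rw [Pi.smul_apply, norm_smul]
    exact mul_le_of_le_one_left (norm_nonneg _) hc
  · rw [← funSchatten_one]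
    exact le_matNormOf (funSchatten μ) _

variable {S : Type*} [Fintype S] {d : S → ℕ}

theorem coeffMatNorm_single_le (i : (s : S) → Fin (d s)) (e : S → E) :
    coeffMatNorm d 1 (Matrix.of fun _ _ s => Matrix.single (i s) (i s) (e s)) ≤
      (∑ s, (d s : ℝ≥0∞) * ENNReal.ofReal ‖e s‖ ^ 2) ^ (1 / 2 : ℝ) := by
  refine matNormOf_le _ (fun s => Matrix.single (i s) (i s) (e s)) fun c hc => ?_
  unfold coeffSchatten
  gcongr with s
  have h : flatten (Matrix.of fun (_ _ : Fin 1) =>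
      (c • fun s => Matrix.single (i s) (i s) (e s) : (s : S) → Matrix (Fin (d s)) (Fin (d s)) E) s)
      = Matrix.single (finProdFinEquiv (0, i s)) (finProdFinEquiv (0, i s)) (c • e s) := by
    ext p q
    obtain ⟨⟨p0, p⟩, rfl⟩ := finProdFinEquiv.surjective p
    obtain ⟨⟨q0, q⟩, rfl⟩ := finProdFinEquiv.surjective q
    rw [Subsingleton.elim p0 0, Subsingleton.elim q0 0]
    simp only [flatten, Equiv.symm_apply_apply, Matrix.of_apply, Pi.smul_apply, Matrix.smul_apply,
      Matrix.single_apply, finProdFinEquiv.injective.eq_iff, Prod.mk.injEq, true_and]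
    split_ifs <;> simp
  simp only [Matrix.of_apply]
  rw [h]
  refine (schattenTwo_single_le _ _).trans (ENNReal.ofReal_le_ofReal ?_)
  rw [norm_smul]
  exact mul_le_of_le_one_left (norm_nonneg _) hc

theorem le_coeffMatNorm (i : (s : S) → Fin (d s)) (A : (s : S) → Matrix (Fin (d s)) (Fin (d s)) E) :
    (∑ s, (d s : ℝ≥0∞) * ENNReal.ofReal ‖A s (i s) (i s)‖ ^ 2) ^ (1 / 2 : ℝ) ≤
      coeffMatNorm d 1 (Matrix.of fun _ _ => A) := by
  refine le_trans ?_ (le_matNormOf _ _)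
  unfold coeffSchatten
  gcongr with s
  refine le_trans (le_of_eq ?_) (ofReal_norm_apply_le_schattenTwo _
    (finProdFinEquiv ((0 : Fin 1), i s)) (finProdFinEquiv ((0 : Fin 1), i s)))
  simp [flatten]

end VectorValued

/-! ### From Riesz type and cotype to the scalar coefficients, and conclusion -/

section Reduction

theorem ofReal_rpow_half_le_iff {a b c : ℝ} (ha : 0 ≤ a) (hb : 0 ≤ b) (hc : 0 ≤ c) :
    ENNReal.ofReal a ^ (1 / 2 : ℝ) ≤ ENNReal.ofReal c * ENNReal.ofReal b ^ (1 / 2 : ℝ) ↔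
      √a ≤ c * √b := by
  rw [ENNReal.ofReal_rpow_of_nonneg ha (by norm_num), ENNReal.ofReal_rpow_of_nonneg hb (by norm_num),
    ← ENNReal.ofReal_mul hc, ENNReal.ofReal_le_ofReal_iff (by positivity), Real.sqrt_eq_rpow,
    Real.sqrt_eq_rpow]

variable {E : Type*} [NormedAddCommGroup E] [NormedSpace ℂ E] {Ω : Type*}
  {S : Type*} {d : S → ℕ} (hd : ∀ s, 0 < d s)
  {ρ : (s : S) → Ω → Matrix.orthogonalGroup (Fin (d s)) ℝ}

/-- The factor `(√(d s))⁻¹` cancels the weight `d s` of the coefficient norm. -/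
theorem sum_natCast_mul_ofReal_norm_sq (hd : ∀ s, 0 < d s) (T : Finset S) (y : S → E) :
    ∑ s : T, (d s : ℝ≥0∞) * ENNReal.ofReal ‖(√(d s))⁻¹ • y s‖ ^ 2 =
      ENNReal.ofReal (∑ s ∈ T, ‖y s‖ ^ 2) := by
  rw [Finset.sum_coe_sort T fun s => (d s : ℝ≥0∞) * ENNReal.ofReal ‖(√(d s))⁻¹ • y s‖ ^ 2,
    ENNReal.ofReal_sum_of_nonneg fun _ _ => by positivity]
  refine Finset.sum_congr rfl fun s _ => ?_
  have h0 : (d s : ℝ) ≠ 0 := by exact_mod_cast (hd s).ne'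
  rw [← ENNReal.ofReal_natCast, ← ENNReal.ofReal_pow (norm_nonneg _),
    ← ENNReal.ofReal_mul (Nat.cast_nonneg _), norm_smul, mul_pow, norm_inv, Real.norm_eq_abs,
    inv_pow, sq_abs, Real.sq_sqrt (Nat.cast_nonneg _), mul_inv_cancel_left₀ h0]

theorem invTransform_single (T : Finset S) (y : S → E) :
    invTransform E (fun s : T => complexify ρ s)
        (fun s : T => Matrix.single ⟨0, hd s⟩ ⟨0, hd s⟩ ((√(d s))⁻¹ • y s)) =
      fun ω => ∑ s ∈ T, corner hd ρ s ω • y s := by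
  funext ω
  rw [← Finset.sum_coe_sort T fun s => corner hd ρ s ω • y s]
  refine Finset.sum_congr rfl fun s _ => ?_
  rw [Finset.sum_eq_single ⟨0, hd s⟩, Finset.sum_eq_single ⟨0, hd s⟩]
  · have h0 : (√(d s) : ℝ) ≠ 0 := Real.sqrt_ne_zero'.2 (by exact_mod_cast hd s)
    have h1 : (d s : ℂ) = (((d s : ℕ) : ℝ) : ℂ) := by simp
    dsimp only
    rw [Matrix.single_apply_same, complexify, Matrix.map_apply, h1, Complex.coe_smul,
      Complex.coe_smul, smul_smul, smul_smul, corner]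
    congr 1
    nth_rewrite 1 [← Real.mul_self_sqrt (Nat.cast_nonneg (d s))]
    field_simp
  · intro j _ hj
    simp [hj.symm]
  · simp
  · intro i _ hi
    refine Finset.sum_eq_zero fun j _ => ?_
    simp [hi.symm]
  · simp

theorem sum_corner_mem_polynomials (T : Finset S) (y : S → E) :
    (fun ω => ∑ s ∈ T, corner hd ρ s ω • y s) ∈ polynomials E fun s : T => complexify ρ s := by
  have h : (fun ω => ∑ s ∈ T, corner hd ρ s ω • y s) =
      ∑ s : T, fun ω => complexify ρ s ω ⟨0, hd s⟩ ⟨0, hd s⟩ • (√(d s) • y s) := by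
    funext ω
    rw [← Finset.sum_coe_sort T fun s => corner hd ρ s ω • y s, Finset.sum_apply]
    refine Finset.sum_congr rfl fun s _ => ?_
    rw [complexify, Matrix.map_apply, Complex.coe_smul, smul_smul, corner, mul_comm]
  rw [h]
  exact Submodule.sum_mem _ fun s _ => Submodule.subset_span ⟨s, _, _, _, rfl⟩

variable [MeasurableSpace Ω] {μ : Measure Ω}

theorem integrable_norm_sq_sum_corner [IsFiniteMeasure μ] (hρ : IsQuantizedRademacher μ ρ)
    (T : Finset S) (y : S → E) :
    Integrable (fun ω => ‖∑ s ∈ T, corner hd ρ s ω • y s‖ ^ 2) μ := by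
  refine Integrable.of_bound (C := (∑ s ∈ T, √(d s) * ‖y s‖) ^ 2) ?_ (ae_of_all _ fun ω => ?_)
  · have hF : StronglyMeasurable fun ω => ∑ s ∈ T, corner hd ρ s ω • y s :=
      Finset.stronglyMeasurable_fun_sum _ fun s _ =>
        (measurable_corner hd hρ s).stronglyMeasurable.smul_const (y s)
    exact (hF.norm.pow 2).aestronglyMeasurable
  · rw [norm_pow, norm_norm]
    gcongr
    refine (norm_sum_le _ _).trans (Finset.sum_le_sum fun s _ => ?_)
    rw [norm_smul]
    gcongr
    exact abs_corner_le hd s ω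

theorem lintegral_norm_sq_sum_corner [IsFiniteMeasure μ] (hρ : IsQuantizedRademacher μ ρ)
    (T : Finset S) (y : S → E) :
    ∫⁻ ω, ENNReal.ofReal ‖∑ s ∈ T, corner hd ρ s ω • y s‖ ^ 2 ∂μ =
      ENNReal.ofReal (∫ ω, ‖∑ s ∈ T, corner hd ρ s ω • y s‖ ^ 2 ∂μ) := by
  rw [ofReal_integral_eq_lintegral_ofReal (integrable_norm_sq_sum_corner hd hρ T y)
    (ae_of_all _ fun ω => by positivity)]
  simp only [ENNReal.ofReal_pow (norm_nonneg _)]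

/-- The corners are orthonormal in `L²`, so the corner of the transform recovers the coefficient up
to normalization. -/
theorem transform_sum_corner [CompleteSpace E] [IsProbabilityMeasure μ]
    (hρ : IsQuantizedRademacher μ ρ) (T : Finset S) (y : S → E) (s : T) :
    transform E μ (fun s : T => complexify ρ s) (fun ω => ∑ t ∈ T, corner hd ρ t ω • y t) s
      ⟨0, hd s⟩ ⟨0, hd s⟩ = (√(d s))⁻¹ • y s := by
  classical
  have h0 : (√(d s) : ℝ) ≠ 0 := Real.sqrt_ne_zero'.2 (by exact_mod_cast hd s)
  have hpt (ω : Ω) : (complexify ρ s ω)ᴴ ⟨0, hd s⟩ ⟨0, hd s⟩ • ∑ t ∈ T, corner hd ρ t ω • y t =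
      (√(d s))⁻¹ • ∑ t ∈ T, (corner hd ρ s ω * corner hd ρ t ω) • y t := by
    rw [Matrix.conjTranspose_apply, complexify, Matrix.map_apply, Complex.star_def,
      Complex.conj_ofReal, Complex.coe_smul, Finset.smul_sum, Finset.smul_sum]
    refine Finset.sum_congr rfl fun t _ => ?_
    rw [smul_smul, smul_smul]
    congr 1
    rw [corner, corner]
    field_simp
  have hint (t : S) : Integrable (fun ω => corner hd ρ s ω * corner hd ρ t ω) μ := by
    refine Integrable.of_bound (C := √(d s) * √(d t)) ((measurable_corner hd hρ s).mul
      (measurable_corner hd hρ t)).aestronglyMeasurable (ae_of_all _ fun ω => ?_)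
    rw [norm_mul]
    exact mul_le_mul (abs_corner_le hd _ ω) (abs_corner_le hd t ω) (norm_nonneg _)
      (Real.sqrt_nonneg _)
  unfold transform
  simp only [hpt]
  rw [integral_smul, integral_finsetSum _ fun t _ => (hint t).smul_const (y t)]
  simp only [integral_smul_const, integral_corner_mul_corner hd hρ]
  congr 1
  simp [ite_smul]

variable [OperatorSpace E] [IsProbabilityMeasure μ]

theorem HasRieszTypeTwo.exists_sqrt_le (hρ : IsQuantizedRademacher μ ρ)
    (h : HasRieszTypeTwo E μ (complexify ρ)) :
    ∃ C : ℝ, 0 ≤ C ∧ ∀ (T : Finset S) (y : S → E),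
      √(∫ ω, ‖∑ s ∈ T, corner hd ρ s ω • y s‖ ^ 2 ∂μ) ≤ C * √(∑ s ∈ T, ‖y s‖ ^ 2) := by
  obtain ⟨C, hC0, hC⟩ := ENNReal.lt_iff_exists_real_btwn.1 h
  refine ⟨C, hC0, fun T y => ?_⟩
  have hT := (le_iSup (fun S₀ : Finset S => cbNorm (coeffMatNorm fun s : S₀ => d s) (funMatNorm μ)
    (⊤ : Submodule ℂ ((s : S₀) → Matrix (Fin (d s)) (Fin (d s)) E))
    (invTransform E fun s : S₀ => complexify ρ s)) T).trans_lt hC.1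
  have h1 := exists_bound_of_cbNorm_lt hT
    (v := fun s : T => Matrix.single ⟨0, hd s⟩ ⟨0, hd s⟩ ((√(d s))⁻¹ • y s)) trivial
  rw [invTransform_single hd T y, funMatNorm_one, lintegral_norm_sq_sum_corner hd hρ] at h1
  rw [← ofReal_rpow_half_le_iff (integral_nonneg fun ω => by positivity) (by positivity) hC0]
  refine h1.trans ?_
  gcongr
  rw [← sum_natCast_mul_ofReal_norm_sq hd]
  exact coeffMatNorm_single_le (fun s : T => ⟨0, hd s⟩) _

theorem HasRieszCotypeTwo.exists_sqrt_le [CompleteSpace E] (hρ : IsQuantizedRademacher μ ρ)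
    (h : HasRieszCotypeTwo E μ (complexify ρ)) :
    ∃ C : ℝ, 0 ≤ C ∧ ∀ (T : Finset S) (y : S → E),
      √(∑ s ∈ T, ‖y s‖ ^ 2) ≤ C * √(∫ ω, ‖∑ s ∈ T, corner hd ρ s ω • y s‖ ^ 2 ∂μ) := by
  obtain ⟨C, hC0, hC⟩ := ENNReal.lt_iff_exists_real_btwn.1 h
  refine ⟨C, hC0, fun T y => ?_⟩
  have hT := (le_iSup (fun S₀ : Finset S => cbNorm (funMatNorm μ) (coeffMatNorm fun s : S₀ => d s)
    (polynomials E fun s : S₀ => complexify ρ s)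
    (transform E μ fun s : S₀ => complexify ρ s)) T).trans_lt hC.1
  have h1 := exists_bound_of_cbNorm_lt hT (sum_corner_mem_polynomials hd T y)
  rw [funMatNorm_one, lintegral_norm_sq_sum_corner hd hρ] at h1
  rw [← ofReal_rpow_half_le_iff (by positivity) (integral_nonneg fun ω => by positivity) hC0]
  refine le_trans ?_ h1
  refine le_trans (le_of_eq ?_) (le_coeffMatNorm (fun s : T => ⟨0, hd s⟩) _)
  simp only [transform_sum_corner hd hρ]
  rw [sum_natCast_mul_ofReal_norm_sq hd]

theorem hasRademacherTypeTwo_of_hasRieszTypeTwo (hd : ∀ s, 0 < d s) [Infinite S]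
    (hρ : IsQuantizedRademacher μ ρ)
    (h : HasRieszTypeTwo E μ (complexify ρ)) : HasRademacherTypeTwo E := by
  obtain ⟨C, hC0, hC⟩ := h.exists_sqrt_le hd hρ
  refine ⟨8 * C, fun n x => ?_⟩
  -- Infinitely many indices make room for any number of vectors; the values of the extension off
  -- the range of `e` play no role.
  let e : Fin n ↪ S := (Fin.valEmbedding).trans (Infinite.natEmbedding S)
  have h1 := hC (Finset.univ.map e) (Function.extend e x 0)
  simp only [Finset.sum_map, e.injective.extend_apply] at h1
  have h2 := rademacherMean_le_integral_norm_sq μ x (g := fun k => corner hd ρ (e k))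
    (B := ∑ k, √(d (e k))) (fun k => measurable_corner hd hρ (e k))
    (fun k ω => (abs_corner_le hd (e k) ω).trans
      (Finset.single_le_sum (f := fun k => √(d (e k) : ℝ)) (fun _ _ => Real.sqrt_nonneg _)
        (Finset.mem_univ k)))
    ((iIndepFun_corner hd hρ).precomp e.injective) (fun k => map_neg_corner hd hρ (e k))
    (fun k => integral_corner_sq hd hρ (e k)) (fun k => integral_corner_pow_four_le hd hρ (e k))
  calc √(rademacherMean x) ≤ √(8 ^ 2 * ∫ ω, ‖∑ k, corner hd ρ (e k) ω • x k‖ ^ 2 ∂μ) := by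
        refine Real.sqrt_le_sqrt (h2.trans (le_of_eq ?_)); norm_num
    _ = 8 * √(∫ ω, ‖∑ k, corner hd ρ (e k) ω • x k‖ ^ 2 ∂μ) := by
        rw [Real.sqrt_mul (by positivity), Real.sqrt_sq (by norm_num)]
    _ ≤ 8 * (C * √(∑ k, ‖x k‖ ^ 2)) := by gcongr
    _ = _ := by ring

theorem hasRademacherCotypeTwo_of_hasRieszCotypeTwo (hd : ∀ s, 0 < d s)
    [CompleteSpace E] [Infinite S]
    (hρ : IsQuantizedRademacher μ ρ) (h : HasRieszCotypeTwo E μ (complexify ρ)) :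
    HasRademacherCotypeTwo E := by
  obtain ⟨C, hC0, hC⟩ := h.exists_sqrt_le hd hρ
  -- Chosen so that `C² * 256 / 4^a ≤ 1/2`, which makes the tail cost at most half of `K`.
  obtain ⟨a, ha⟩ := pow_unbounded_of_one_lt (C ^ 2 * 512) (show (1 : ℝ) < 4 by norm_num)
  have ha4 : (0 : ℝ) < 4 ^ a := by positivity
  have hbound (N : ℕ) : CotypeBound E N (2 * (C ^ 2 * (8 * 4 ^ a)) + 1) := by
    refine CotypeBound.of_improvement (by positivity) fun K hK0 hK n x hx => ?_
    let e : Fin n ↪ S := (Fin.valEmbedding).trans (Infinite.natEmbedding S)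
    have h1 := hC (Finset.univ.map e) (Function.extend e x 0)
    simp only [Finset.sum_map, e.injective.extend_apply] at h1
    -- A crude bound for these finitely many indices; it secures integrability and ends the dyadic
    -- recursion but enters no constant.
    have hB (k : Fin n) (ω : Ω) : |corner hd ρ (e k) ω| ≤ ∑ k, √(d (e k)) :=
      (abs_corner_le hd (e k) ω).trans (Finset.single_le_sum (f := fun k => √(d (e k) : ℝ))
        (fun _ _ => Real.sqrt_nonneg _) (Finset.mem_univ k))
    have h2 := integral_norm_sq_eq_integral_weightedMean μ x (g := fun k => corner hd ρ (e k))
      (fun k => measurable_corner hd hρ (e k)) hB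
      ((iIndepFun_corner hd hρ).precomp e.injective) (fun k => map_neg_corner hd hρ (e k))
    have h3 := hK.integral_weightedMean_le hK0 μ x hx (g := fun k => corner hd ρ (e k))
      (fun k => measurable_corner hd hρ (e k)) hB
      (fun k => integral_corner_pow_four_le hd hρ (e k)) a
    rw [← h2] at h3
    have h4 : ∑ k, ‖x k‖ ^ 2 ≤ C ^ 2 * ∫ ω, ‖∑ k, corner hd ρ (e k) ω • x k‖ ^ 2 ∂μ := by
      have := pow_le_pow_left₀ (Real.sqrt_nonneg _) h1 2
      rwa [mul_pow, Real.sq_sqrt (by positivity),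
        Real.sq_sqrt (integral_nonneg fun ω => by positivity)] at this
    have h5 : C ^ 2 * (256 * K / 4 ^ a) ≤ K / 2 := by
      rw [← mul_div_assoc, div_le_iff₀ ha4]
      nlinarith
    have hr := rademacherMean_nonneg x
    calc ∑ k, ‖x k‖ ^ 2 ≤ C ^ 2 * ((8 * 4 ^ a + 256 * K / 4 ^ a) * rademacherMean x) :=
          h4.trans (by gcongr)
      _ = (C ^ 2 * (8 * 4 ^ a) + C ^ 2 * (256 * K / 4 ^ a)) * rademacherMean x := by ring
      _ ≤ _ := by gcongr
  refine ⟨√(2 * (C ^ 2 * (8 * 4 ^ a)) + 1), fun n x => ?_⟩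
  rw [← Real.sqrt_mul (by positivity)]
  -- The constant in `hbound` is free of `N`, so `N = n` is allowed.
  refine Real.sqrt_le_sqrt (hbound n n x ?_)
  calc _ ≤ (Set.univ : Set (Fin n)).ncard := Set.ncard_le_ncard (Set.subset_univ _)
    _ = n := by simp

end Reduction

end QuantizedSystem

theorem lemma3p6 {E : Type*} [NormedAddCommGroup E] [NormedSpace ℂ E] [CompleteSpace E]
    [QuantizedSystem.OperatorSpace E]
    {Ω : Type*} [MeasurableSpace Ω] (μ : Measure Ω) [IsProbabilityMeasure μ]
    {S : Type*} [Infinite S] (d : S → ℕ) (hd : ∀ s, 0 < d s)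
    (ρ : (s : S) → Ω → Matrix.orthogonalGroup (Fin (d s)) ℝ)
    (hρ : QuantizedSystem.IsQuantizedRademacher μ ρ) :
    (QuantizedSystem.HasRieszTypeTwo E μ (QuantizedSystem.complexify ρ) →
      QuantizedSystem.HasRademacherTypeTwo E) ∧
    (QuantizedSystem.HasRieszCotypeTwo E μ (QuantizedSystem.complexify ρ) →
      QuantizedSystem.HasRademacherCotypeTwo E) :=
  ⟨QuantizedSystem.hasRademacherTypeTwo_of_hasRieszTypeTwo hd hρ,
    QuantizedSystem.hasRademacherCotypeTwo_of_hasRieszCotypeTwo hd hρ⟩
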